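/- **Corollary (hardness of diameter distinction in the RAM model, under OVH).** The model is the deterministic unit-cost word RAM: a program is a finite list of instructions (constants, addition, truncated subtraction, multiplication, division, remainder, bitwise operations, shifts, indirect loads and stores, random access to a read-only input, jumps), registers and memory are initially zero, every instruction takes one time step, and on an input consisting of $N$ numbers all registers and memory cells hold only numbers of $O(\log N)$ bits, i.e. numbers at most $(N+2)^c$ for a constant $c$ of the algorithm. The *Orthogonal Vectors Hypothesis* (OVH) states that for no constant $\delta>0$ there is a RAM algorithm which, given two families $L=(l_1,\dots,l_n)$ and $R=(r_1,\dots,r_n)$ of $n\ge 1$ bit vectors of dimension $d\ge 1$, decides in time $O(n^{2-\delta}\operatorname{poly}(d))$ whether there are $i,j$ with $l_i[k]=0$ or $r_j[k]=0$ for every coordinate $k$. Assume OVH. Let $S$ be any nonempty set of pairs $(\ell,q)$ of integers with $\ell\ge 1$ and $q\ge 0$ (for instance a single fixed pair, or all such pairs), and let $\delta>0$ be a constant. Then there is no RAM algorithm which, given $(\ell,q)\in S$ and an unweighted undirected simple graph $G$ with $m$ edges (as its number of vertices and a list of its edges) whose diameter is either $2\ell+q$ or $3\ell+q$, decides which of the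 two is the case in time $$O\!\left(\frac{m^{2-\delta}}{(\ell+q)^{2-\delta}}\right),$$ where the constant in the $O(\cdot)$ is uniform over $S$. In particular, for every fixed $\ell\ge 1$ and $q\ge 0$, no RAM algorithm distinguishes graphs of diameter $2\ell+q$ from graphs of diameter $3\ell+q$ in this time. -/

import Mathlib

namespace RAM

/-- The two-operand operations of the word RAM. -/
inductive Op where
  | add | sub | mul | div | mod | land | lor | xor | shl | shr

/-- Operations act on natural numbers; subtraction is truncated, and division by zero gives zero. -/
def Op.eval : Op → ℕ → ℕ → ℕ
  | .add, a, b => a + b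
  | .sub, a, b => a - b
  | .mul, a, b => a * b
  | .div, a, b => a / b
  | .mod, a, b => a % b
  | .land, a, b => a &&& b
  | .lor, a, b => a ||| b
  | .xor, a, b => a ^^^ b
  | .shl, a, b => a <<< b
  | .shr, a, b => a >>> b

/-- RAM instructions. Registers are named by natural numbers; a program mentions finitely many
of them. The memory and the read-only input are addressed indirectly through registers. -/
inductive Instr where
  /-- `reg r := k` -/
  | const (r k : ℕ)
  /-- `reg r := o (reg s) (reg t)` -/
  | op (o : Op) (r s t : ℕ)
  /-- `reg r := mem (reg s)` -/
  | load (r s : ℕ)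
  /-- `mem (reg r) := reg s` -/
  | store (r s : ℕ)
  /-- `reg r := input (reg s)`, which is zero beyond the end of the input -/
  | input (r s : ℕ)
  /-- go to instruction `p` -/
  | jump (p : ℕ)
  /-- go to instruction `p` if `reg r = 0` -/
  | jumpZero (r p : ℕ)
  /-- halt with the answer `b` -/
  | halt (b : Bool)

/-- A RAM program is a finite list of instructions. -/
abbrev Program := List Instr

/-- A configuration: program counter, registers, and random access memory. -/
structure Config where
  pc : ℕ
  reg : ℕ → ℕ
  mem : ℕ → ℕ

/-- The initial configuration: everything is zero. -/
def Config.init : Config := ⟨0, fun _ => 0, fun _ => 0⟩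

/-- The effect of one instruction on input `x`. -/
def Instr.exec (x : List ℕ) (c : Config) : Instr → Config
  | .const r k => { c with pc := c.pc + 1, reg := Function.update c.reg r k }
  | .op o r s t =>
      { c with pc := c.pc + 1, reg := Function.update c.reg r (o.eval (c.reg s) (c.reg t)) }
  | .load r s => { c with pc := c.pc + 1, reg := Function.update c.reg r (c.mem (c.reg s)) }
  | .store r s => { c with pc := c.pc + 1, mem := Function.update c.mem (c.reg r) (c.reg s) }
  | .input r s => { c with pc := c.pc + 1, reg := Function.update c.reg r (x.getD (c.reg s) 0) }
  | .jump p => { c with pc := p }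
  | .jumpZero r p => { c with pc := if c.reg r = 0 then p else c.pc + 1 }
  | .halt _ => c

/-- One (unit-cost) step of the program `P` on input `x`. A configuration without a next
instruction is stuck. -/
def step (P : Program) (x : List ℕ) (c : Config) : Config :=
  match P[c.pc]? with
  | some i => i.exec x c
  | none => c

/-- The configuration after `t` steps of `P` on input `x`. -/
def run (P : Program) (x : List ℕ) (t : ℕ) : Config := (step P x)^[t] Config.init

/-- On input `x` the program `P` halts with the answer `b` after at most `t` steps, and during this
run no register or memory cell ever holds a number greater than `B`. (A halting instruction leaves
the configuration unchanged, so "at `t`" is the same as "at or before `t`".) -/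
def HaltsWithin (P : Program) (x : List ℕ) (b : Bool) (t B : ℕ) : Prop :=
  P[(run P x t).pc]? = some (.halt b) ∧
    ∀ t' ≤ t, ∀ a : ℕ, (run P x t').reg a ≤ B ∧ (run P x t').mem a ≤ B

/-- The largest number allowed in a word: words have `O(log N)` bits on inputs of length `N`,
i.e. they hold numbers up to `(N + 2) ^ c` for a constant `c`. -/
def wordBound (c : ℕ) (x : List ℕ) : ℕ := (x.length + 2) ^ c

end RAM

namespace OrthogonalVectors

/-- There are `i` and `j` such that in each coordinate `k`, `L i` or `R j` is `0`. -/
def HasOrthogonalPair {n d : ℕ} (L R : Fin n → Fin d → Bool) : Prop :=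
  ∃ i j, ∀ k, L i k = false ∨ R j k = false

/-- The entries of a bit matrix, row by row. -/
def encodeRows {n d : ℕ} (M : Fin n → Fin d → Bool) : List ℕ :=
  (List.ofFn fun i => List.ofFn fun k => (M i k).toNat).flatten

/-- An instance as RAM input: `n`, `d`, the vectors of `L`, the vectors of `R`. -/
def encode {n d : ℕ} (L R : Fin n → Fin d → Bool) : List ℕ :=
  n :: d :: (encodeRows L ++ encodeRows R)

open Classical in
/-- The Orthogonal Vectors Hypothesis: for no constant `δ > 0` there is a RAM program deciding
whether two given families of `n` bit vectors of dimension `d` contain an orthogonal pair in time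
`O(n ^ (2 - δ) * poly(d))`. The polynomial absorbs the constant of the `O`. -/
def Hypothesis : Prop :=
  ∀ δ : ℝ, 0 < δ →
    ¬ ∃ (P : RAM.Program) (c : ℕ) (p : Polynomial ℕ),
      ∀ (n d : ℕ), 1 ≤ n → 1 ≤ d → ∀ (L R : Fin n → Fin d → Bool),
        ∃ t : ℕ, (t : ℝ) ≤ (n : ℝ) ^ (2 - δ) * (p.eval d : ℕ) ∧
          RAM.HaltsWithin P (encode L R) (decide (HasOrthogonalPair L R)) t
            (RAM.wordBound c (encode L R))

end OrthogonalVectors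

namespace GraphInput

/-- `es` lists every edge of `G` exactly once, in any order and with any orientation. -/
def IsEdgeList {N : ℕ} (G : SimpleGraph (Fin N)) (es : List (Fin N × Fin N)) : Prop :=
  (es.map fun e => s(e.1, e.2)).Nodup ∧
    ∀ e : Sym2 (Fin N), e ∈ (es.map fun e => s(e.1, e.2)) ↔ e ∈ G.edgeSet

/-- RAM input for a graph with vertices `0, …, N - 1` and parameters `ℓ` and `q`: the number of
vertices, the number of edges, `ℓ`, `q`, and the edge list. -/
def encode {N : ℕ} (es : List (Fin N × Fin N)) (ℓ q : ℕ) : List ℕ :=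
  N :: es.length :: ℓ :: q :: es.flatMap fun e => [(e.1 : ℕ), (e.2 : ℕ)]

end GraphInput

/-- The program `P`, with words of `c * log` of the input length, distinguishes graphs of diameter
`2ℓ + q` (answer `false`) from graphs of diameter `3ℓ + q` (answer `true`), for all parameters
`(ℓ, q) ∈ S`, in at most `T m ℓ q` steps, where `m` is the number of edges. Nothing is required on
graphs of any other diameter. -/
def DistinguishesDiameter (S : Set (ℕ × ℕ)) (P : RAM.Program) (c : ℕ) (T : ℕ → ℕ → ℕ → ℝ) :
    Prop :=
  ∀ (ℓ q : ℕ), (ℓ, q) ∈ S →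
    ∀ (N : ℕ) (G : SimpleGraph (Fin N)) (es : List (Fin N × Fin N)),
      GraphInput.IsEdgeList G es → ∀ b : Bool,
        G.ediam = ((if b then 3 * ℓ + q else 2 * ℓ + q : ℕ) : ℕ∞) →
          ∃ t : ℕ, (t : ℝ) ≤ T G.edgeSet.ncard ℓ q ∧
            RAM.HaltsWithin P (GraphInput.encode es ℓ q) b t
              (RAM.wordBound c (GraphInput.encode es ℓ q))

/-!
The proof is a fine-grained reduction from orthogonal vectors. A pair `(ℓ, q) ∈ S` is fixed, so that
`ℓ` and `q` count as constants. From two families of `n` vectors of dimension `d` a graph with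
`O(n * d)` edges is built whose diameter is `3 * ℓ + q` if there is an orthogonal pair, and
`2 * ℓ + q` otherwise (`OVGraph.ediam_numberedGraph_eq`).

The graph. Write `ℓ = h + a` with `h = ⌊ℓ / 2⌋` and `a = ⌈ℓ / 2⌉`. Each vector has a pendant path of
length `h`, each coordinate a path of length `q` that leads from the left to the right side, and
each side has a center and a hub at distance `h` from it; the two centers are joined by a path of
length `ℓ + q`. Paths of length `a` connect the root of each vector to the center of its side and to
the coordinates in which the vector is one, and the hub of each side to all coordinates. So the
tips of two vectors on different sides are joined by a path of length `h + a + q + a + h` through a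
common coordinate, and if there is none, the way through the centers, of length `3 * ℓ + q`, is
shortest. All vertices of a side lie within distance `ℓ` of its center, and within distance `h` of
a root or hub, which gives the upper bounds (`OVGraph.ediam_le_of_cross`). The lower bounds come
from functions on the vertices that change by at most one per edge (`Skeleton.le_edist`).

The number of edges must not depend on the vectors, so that the edge list can be accessed in a
simple way. To this end each coordinate has three copies. A one is represented by the first copy on
both sides, a zero on the left side by the second, and a zero on the right side by the third. Every
vector is then connected to exactly one copy of each coordinate, and the two sides meet exactly in
the common ones.

The simulation. With this, each entry of the encoded graph is the value of an arithmetic expression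
in its position and the entries of the encoded vectors (`OVGraph.exists_expr_encode`). Truncated
subtraction expresses case distinctions, and so an expression is evaluated by straight-line code of
constant length. The graph is never written down: the program for graphs is run with each access to
its input replaced by such code (`RAM.HaltsWithin.virtualize`), at the cost of a constant factor in
time. All intermediate values are polynomially bounded (`RAM.Expr.exists_peak_le`), hence fit into
words.
-/

/-! ### Straight-line evaluation of arithmetic expressions -/

namespace RAM

/-- Arithmetic expressions in one variable, with random access to the input. Only operations of
polynomial growth are allowed, so that all intermediate values fit into words. -/
inductive Expr where
  | const (k : ℕ)
  | var
  | op (o : Op) (ho : ∀ a b, o.eval a b ≤ (a + 1) * (b + 1)) (a b : Expr)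
  | input (a : Expr)

namespace Expr

/-- The value of an expression on the input `x` with the variable set to `p`. -/
def eval (x : List ℕ) (p : ℕ) : Expr → ℕ
  | const k => k
  | var => p
  | op o _ a b => o.eval (a.eval x p) (b.eval x p)
  | input a => x.getD (a.eval x p) 0

/-- A bound for all values that occur while the expression is evaluated. -/
def peak (x : List ℕ) (p : ℕ) : Expr → ℕ
  | const k => k
  | var => p
  | op o ho a b => max (max (a.peak x p) (b.peak x p)) ((op o ho a b).eval x p)
  | input a => max (a.peak x p) ((input a).eval x p)

/-- Straight-line code that puts the value of an expression in the variable stored in register `v`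
into register `r`, overwriting registers from `r` on only. -/
def compile (v : ℕ) : ℕ → Expr → List Instr
  | r, const k => [.const r k]
  | r, var => [.const r 0, .op .add r r v]
  | r, op o _ a b => a.compile v r ++ (b.compile v (r + 1) ++ [.op o r r (r + 1)])
  | r, input a => a.compile v r ++ [.input r r]

theorem length_compile (v w r s : ℕ) (e : Expr) :
    (e.compile v r).length = (e.compile w s).length := by
  induction e generalizing r s with
  | const k => rfl
  | var => rfl
  | op o ho a b iha ihb => simp [compile, iha r s, ihb (r + 1) (s + 1)]
  | input a iha => simp [compile, iha r s]

end Expr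

/-- All registers and memory cells hold numbers of at most `B`. -/
def Config.Bounded (B : ℕ) (c : Config) : Prop :=
  ∀ a, c.reg a ≤ B ∧ c.mem a ≤ B

/-- The configuration after executing the instructions `l` one after the other. -/
def execAll (x : List ℕ) (c : Config) (l : List Instr) : Config :=
  l.foldl (fun c i => i.exec x c) c

/-- Executing the instructions `l` one after the other keeps all numbers at most `B`. -/
def Safe (x : List ℕ) (B : ℕ) : Config → List Instr → Prop
  | c, [] => c.Bounded B
  | c, i :: l => c.Bounded B ∧ Safe x B (i.exec x c) l

theorem execAll_append (x : List ℕ) (c : Config) (l l' : List Instr) :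
    execAll x c (l ++ l') = execAll x (execAll x c l) l' := by
  simp [execAll]

theorem Safe.append {x : List ℕ} {B : ℕ} {c : Config} {l l' : List Instr} (h : Safe x B c l)
    (h' : Safe x B (execAll x c l) l') : Safe x B c (l ++ l') := by
  induction l generalizing c with
  | nil => exact h'
  | cons i l ih => exact ⟨h.1, ih h.2 h'⟩

theorem Safe.bounded {x : List ℕ} {B : ℕ} {c : Config} {l : List Instr} (h : Safe x B c l) :
    (execAll x c l).Bounded B := by
  induction l generalizing c with
  | nil => exact h
  | cons i l ih => exact ih h.2

/-- The instruction always proceeds to the next one. -/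
def Instr.Straight (i : Instr) : Prop :=
  ∀ x c, (i.exec x c).pc = c.pc + 1

theorem Config.Bounded.update {B : ℕ} {c : Config} (h : c.Bounded B) (p r : ℕ) {k : ℕ}
    (hk : k ≤ B) : Config.Bounded B ⟨p, Function.update c.reg r k, c.mem⟩ := by
  intro a
  refine ⟨?_, (h a).2⟩
  by_cases ha : a = r
  · subst ha; simpa using hk
  · simpa [Function.update_of_ne ha] using (h a).1

theorem Expr.straight_of_mem_compile {v r : ℕ} {e : Expr} {i : Instr} (hi : i ∈ e.compile v r) :
    i.Straight := by
  induction e generalizing r with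
  | const k => simp only [compile, List.mem_singleton] at hi; subst hi; intro x c; rfl
  | var =>
    simp only [compile, List.mem_cons, List.not_mem_nil, or_false] at hi
    rcases hi with rfl | rfl <;> (intro x c; rfl)
  | op o ho a b iha ihb =>
    simp only [compile, List.mem_append, List.mem_singleton] at hi
    rcases hi with hi | hi | rfl
    · exact iha hi
    · exact ihb hi
    · intro x c; rfl
  | input a iha =>
    simp only [compile, List.mem_append, List.mem_singleton] at hi
    rcases hi with hi | rfl
    · exact iha hi
    · intro x c; rfl

theorem Expr.eval_le_peak (x : List ℕ) (p : ℕ) (e : Expr) : e.eval x p ≤ e.peak x p := by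
  cases e <;> simp [eval, peak]

theorem Expr.execAll_compile {x : List ℕ} {B v r : ℕ} {c : Config} (e : Expr) (hv : v < r)
    (hc : c.Bounded B) (he : e.peak x (c.reg v) ≤ B) :
    Safe x B c (e.compile v r) ∧
      (execAll x c (e.compile v r)).mem = c.mem ∧
      (∀ s < r, (execAll x c (e.compile v r)).reg s = c.reg s) ∧
      (execAll x c (e.compile v r)).reg r = e.eval x (c.reg v) := by
  induction e generalizing r c with
  | const k =>
    refine ⟨⟨hc, hc.update _ _ he⟩, rfl, fun s hs => ?_, ?_⟩
    · simp [compile, execAll, Instr.exec, hs.ne]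
    · simp [compile, execAll, Instr.exec, eval]
  | var =>
    have h1 : (c.reg v) ≤ B := he
    refine ⟨⟨hc, hc.update _ _ (Nat.zero_le B), ?_⟩, rfl, fun s hs => ?_, ?_⟩
    · refine Config.Bounded.update (hc.update (c.pc + 1) r (Nat.zero_le B)) _ _ ?_
      simpa [Op.eval, Instr.exec, hv.ne] using h1
    · simp [compile, execAll, Instr.exec, hs.ne]
    · simp [compile, execAll, Instr.exec, eval, Op.eval, hv.ne]
  | op o ho a b iha ihb =>
    simp only [peak, max_le_iff] at he
    obtain ⟨sa, ma, ra, va⟩ := iha hv hc he.1.1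
    have hcv := ra v hv
    obtain ⟨sb, mb, rb, vb⟩ := ihb (c := execAll x c (a.compile v r))
      (hv.trans (Nat.lt_succ_self r)) sa.bounded (by rw [hcv]; exact he.1.2)
    rw [hcv] at vb
    have hr := rb r (Nat.lt_succ_self r)
    rw [va] at hr
    simp only [compile, execAll_append]
    set c' := execAll x (execAll x c (a.compile v r)) (b.compile v (r + 1)) with hc'
    have hval : o.eval (c'.reg r) (c'.reg (r + 1)) = (op o ho a b).eval x (c.reg v) := by
      rw [hr, vb]; rfl
    refine ⟨sa.append (sb.append ⟨sb.bounded, sb.bounded.update _ _ (hval ▸ he.2)⟩), ?_, ?_, ?_⟩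
    · exact mb.trans ma
    · intro s hs
      simp only [execAll, List.foldl_cons, List.foldl_nil, Instr.exec, Function.update_of_ne hs.ne]
      rw [rb s (hs.trans (Nat.lt_succ_self r)), ra s hs]
    · simp only [execAll, List.foldl_cons, List.foldl_nil, Instr.exec, Function.update_self]
      exact hval
  | input a iha =>
    simp only [peak, max_le_iff] at he
    obtain ⟨sa, ma, ra, va⟩ := iha hv hc he.1
    simp only [compile, execAll_append]
    set c' := execAll x c (a.compile v r) with hc'
    have hval : x.getD (c'.reg r) 0 = (input a).eval x (c.reg v) := by
      rw [va]; rfl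
    refine ⟨sa.append ⟨sa.bounded, sa.bounded.update _ _ (hval ▸ he.2)⟩, ma, ?_, ?_⟩
    · intro s hs
      simp only [execAll, List.foldl_cons, List.foldl_nil, Instr.exec, Function.update_of_ne hs.ne]
      exact ra s hs
    · simp only [execAll, List.foldl_cons, List.foldl_nil, Instr.exec, Function.update_self]
      exact hval

/-! ### Simulation of a program on a virtual input -/

/-- The program leads from `c` to `c'` in `k` steps, with all numbers at most `B` on the way. -/
def Reaches (P : Program) (x : List ℕ) (B : ℕ) (c c' : Config) (k : ℕ) : Prop :=
  (step P x)^[k] c = c' ∧ ∀ k' ≤ k, ((step P x)^[k'] c).Bounded B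

theorem Reaches.refl {P : Program} {x : List ℕ} {B : ℕ} {c : Config} (h : c.Bounded B) :
    Reaches P x B c c 0 :=
  ⟨rfl, fun k' hk' => by obtain rfl : k' = 0 := by omega
                         exact h⟩

theorem Reaches.trans {P : Program} {x : List ℕ} {B : ℕ} {c c' c'' : Config} {k k' : ℕ}
    (h : Reaches P x B c c' k) (h' : Reaches P x B c' c'' k') : Reaches P x B c c'' (k + k') := by
  refine ⟨by rw [add_comm, Function.iterate_add_apply, h.1, h'.1], fun j hj => ?_⟩
  rcases le_total j k with hjk | hjk
  · exact h.2 j hjk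
  · obtain ⟨i, rfl⟩ := Nat.exists_eq_add_of_le hjk
    rw [add_comm, Function.iterate_add_apply, h.1]
    exact h'.2 i (by omega)

theorem Reaches.single {P : Program} {x : List ℕ} {B : ℕ} {c : Config} {i : Instr}
    (hi : P[c.pc]? = some i) (h : c.Bounded B) (h' : (i.exec x c).Bounded B) :
    Reaches P x B c (i.exec x c) 1 := by
  have hs : step P x c = i.exec x c := by simp [step, hi]
  refine ⟨by simp [hs], fun k' hk' => ?_⟩
  obtain rfl | rfl : k' = 0 ∨ k' = 1 := by omega
  · exact h
  · simpa [hs] using h'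

theorem reaches_execAll {P : Program} {x : List ℕ} {B : ℕ} {c : Config} {l : List Instr}
    (hP : ∀ k (hk : k < l.length), P[c.pc + k]? = some l[k]) (hl : ∀ i ∈ l, i.Straight)
    (hs : Safe x B c l) :
    Reaches P x B c (execAll x c l) l.length ∧ (execAll x c l).pc = c.pc + l.length := by
  induction l generalizing c with
  | nil => exact ⟨Reaches.refl hs, rfl⟩
  | cons i l ih =>
    have hpc : (i.exec x c).pc = c.pc + 1 := hl i (by simp) x c
    have h0 : P[c.pc]? = some i := hP 0 (by simp)
    have hb : (i.exec x c).Bounded B := by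
      cases l with
      | nil => exact hs.2
      | cons j l => exact hs.2.1
    obtain ⟨h1, h2⟩ := ih (c := i.exec x c)
      (fun k hk => by
        have := hP (k + 1) (by simpa using hk)
        rw [hpc, add_assoc, add_comm 1 k]
        simpa using this)
      (fun j hj => hl j (by simp [hj])) hs.2
    refine ⟨?_, ?_⟩
    · have := (Reaches.single h0 hs.1 hb).trans h1
      rwa [add_comm] at this
    · show (execAll x (i.exec x c) l).pc = _
      rw [h2, hpc, List.length_cons]; omega

/-- All registers mentioned in the instruction are below `R`. -/
def Instr.UsesBelow (R : ℕ) : Instr → Prop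
  | .const r _ => r < R
  | .op _ r s t => r < R ∧ s < R ∧ t < R
  | .load r s => r < R ∧ s < R
  | .store r s => r < R ∧ s < R
  | .input r s => r < R ∧ s < R
  | .jump _ => True
  | .jumpZero r _ => r < R
  | .halt _ => True

theorem Instr.exists_usesBelow (i : Instr) : ∃ R, ∀ R' ≥ R, i.UsesBelow R' := by
  cases i with
  | const r k => exact ⟨r + 1, fun R' h => by simp only [UsesBelow]; omega⟩
  | op o r s t => exact ⟨r + s + t + 1, fun R' h => by simp only [UsesBelow]; omega⟩
  | load r s => exact ⟨r + s + 1, fun R' h => by simp only [UsesBelow]; omega⟩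
  | store r s => exact ⟨r + s + 1, fun R' h => by simp only [UsesBelow]; omega⟩
  | input r s => exact ⟨r + s + 1, fun R' h => by simp only [UsesBelow]; omega⟩
  | jump p => exact ⟨0, fun R' h => trivial⟩
  | jumpZero r p => exact ⟨r + 1, fun R' h => by simp only [UsesBelow]; omega⟩
  | halt b => exact ⟨0, fun R' h => trivial⟩

theorem Program.exists_usesBelow (P : Program) : ∃ R, ∀ i ∈ P, i.UsesBelow R := by
  have : ∃ R, ∀ R' ≥ R, ∀ i ∈ P, i.UsesBelow R' := by
    induction P with
    | nil => exact ⟨0, by simp⟩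
    | cons i P ih =>
      obtain ⟨R, hR⟩ := ih
      obtain ⟨S, hS⟩ := i.exists_usesBelow
      refine ⟨max R S, fun R' h j hj => ?_⟩
      rcases List.mem_cons.1 hj with rfl | hj
      · exact hS R' (le_trans (le_max_right _ _) h)
      · exact hR R' (le_trans (le_max_left _ _) h) j hj
  obtain ⟨R, hR⟩ := this
  exact ⟨R, hR R le_rfl⟩

/-- The code simulating one instruction: a read access to the virtual input is replaced by the
evaluation of the expression `e`, and jumps are redirected to the blocks of `K` instructions that
simulate the single instructions. The registers from `R` on are used for auxiliary results. -/
def Instr.block (e : Expr) (R K : ℕ) : Instr → List Instr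
  | .input r s => e.compile s R ++ [.const (R + 1) 0, .op .add r R (R + 1)]
  | .jump p => [.jump (K * p)]
  | .jumpZero r p => [.jumpZero r (K * p)]
  | i => [i]

/-- The length of the blocks: it leaves room for a jump at the end of each block. -/
def blockLength (e : Expr) : ℕ := (e.compile 0 0).length + 3

/-- The program `P`, reading the values of the expression `e` instead of its input. Each
instruction of `P` becomes a block of fixed length, filled up with jumps to the next block. -/
def Program.virtualize (P : Program) (e : Expr) (R : ℕ) : Program :=
  (List.range (blockLength e * P.length)).map fun j =>
    ((P.getD (j / blockLength e) (.halt false)).block e R (blockLength e)).getD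
      (j % blockLength e) (.jump (blockLength e * (j / blockLength e + 1)))

theorem Instr.length_block (e : Expr) (R K : ℕ) (i : Instr) :
    (i.block e R K).length < blockLength e := by
  cases i with
  | input r s => simp [block, blockLength, e.length_compile s 0 R 0]
  | _ => simp [block, blockLength]

theorem Program.getElem?_virtualize {P : Program} (e : Expr) (R : ℕ) {a k : ℕ} {i : Instr}
    (hi : P[a]? = some i) (hk : k < blockLength e) :
    (P.virtualize e R)[blockLength e * a + k]? =
      some ((i.block e R (blockLength e)).getD k (.jump (blockLength e * (a + 1)))) := by
  have hK : 0 < blockLength e := Nat.succ_pos _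
  obtain ⟨ha, -⟩ := List.getElem?_eq_some_iff.1 hi
  have hlt : blockLength e * a + k < blockLength e * P.length :=
    calc blockLength e * a + k < blockLength e * a + blockLength e := by omega
      _ = blockLength e * (a + 1) := by ring
      _ ≤ _ := Nat.mul_le_mul_left _ ha
  have h1 : (blockLength e * a + k) / blockLength e = a := by
    rw [Nat.mul_add_div hK, Nat.div_eq_of_lt hk, add_zero]
  have h2 : (blockLength e * a + k) % blockLength e = k := by
    rw [Nat.mul_add_mod, Nat.mod_eq_of_lt hk]
  simp [virtualize, hlt, h1, h2, hi]

/-- The configuration `c'` of the simulating program corresponds to the configuration `c`. -/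
structure Simulates (K R : ℕ) (c c' : Config) : Prop where
  pc : c'.pc = K * c.pc
  mem : c'.mem = c.mem
  reg : ∀ r < R, c'.reg r = c.reg r

section
variable {P : Program} {e : Expr} {R : ℕ} {x y : List ℕ} {B B' : ℕ}

theorem reaches_next {i : Instr} {c c' : Config} (hi : P[c.pc]? = some i)
    (hpc : c'.pc = blockLength e * c.pc)
    (hb : Safe x B' c' (i.block e R (blockLength e)))
    (hst : ∀ j ∈ i.block e R (blockLength e), j.Straight) :
    ∃ k ≤ blockLength e, Reaches (P.virtualize e R) x B' c'
      { execAll x c' (i.block e R (blockLength e)) with pc := blockLength e * (c.pc + 1) } k := by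
  have hlen := i.length_block e R (blockLength e)
  obtain ⟨h1, h2⟩ := reaches_execAll (P := P.virtualize e R) (c := c') (fun k hk => by
    rw [hpc, Program.getElem?_virtualize e R hi (hk.trans hlen)]
    simp [hk]) hst hb
  refine ⟨(i.block e R (blockLength e)).length + 1, hlen, h1.trans ?_⟩
  have h3 : (P.virtualize e R)[(execAll x c' (i.block e R (blockLength e))).pc]? =
      some (.jump (blockLength e * (c.pc + 1))) := by
    rw [h2, hpc, Program.getElem?_virtualize e R hi hlen]
    simp
  exact Reaches.single h3 hb.bounded (fun a => hb.bounded a)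

/-- One step of `P` is simulated by one block. -/
theorem Simulates.step (hR : ∀ i ∈ P, i.UsesBelow R) (hBB : B ≤ B')
    (hval : ∀ p ≤ B, e.eval x p = y.getD p 0) (hpeak : ∀ p ≤ B, e.peak x p ≤ B')
    {c c' : Config} (hs : Simulates (blockLength e) R c c') (hc : c.Bounded B)
    (hc2 : (RAM.step P y c).Bounded B) (hc' : c'.Bounded B') :
    ∃ k ≤ blockLength e, ∃ c'', Reaches (P.virtualize e R) x B' c' c'' k ∧
      Simulates (blockLength e) R (RAM.step P y c) c'' := by
  cases hi : P[c.pc]? with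
  | none =>
    refine ⟨0, Nat.zero_le _, c', Reaches.refl hc', ?_⟩
    simpa [RAM.step, hi] using hs
  | some i =>
    have hiR := hR i (List.mem_of_getElem? hi)
    have hstep : RAM.step P y c = i.exec y c := by simp [RAM.step, hi]
    rw [hstep] at hc2 ⊢
    have hK : 0 < blockLength e := Nat.succ_pos _
    have hfst := Program.getElem?_virtualize (P := P) e R hi hK
    rw [add_zero, ← hs.pc] at hfst
    cases i with
    | const r k =>
      have hk : k ≤ B := by simpa [Instr.exec] using (hc2 r).1
      obtain ⟨t, ht, hr⟩ := reaches_next (x := x) (B' := B') (R := R) hi hs.pc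
        ⟨hc', hc'.update _ _ (hk.trans hBB)⟩ (by simp [Instr.block, Instr.Straight, Instr.exec])
      refine ⟨t, ht, _, hr, rfl, hs.mem, fun s hsR => ?_⟩
      by_cases h : s = r
      · subst h; simp [execAll, Instr.block, Instr.exec]
      · simp [execAll, Instr.block, Instr.exec, h, hs.reg s hsR]
    | op o r s t =>
      obtain ⟨h1, h2, h3⟩ := hiR
      have hk : o.eval (c.reg s) (c.reg t) ≤ B := by simpa [Instr.exec] using (hc2 r).1
      obtain ⟨t', ht, hr⟩ := reaches_next (x := x) (B' := B') (R := R) hi hs.pc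
        ⟨hc', hc'.update _ _ (by rw [hs.reg s h2, hs.reg t h3]; exact hk.trans hBB)⟩
        (by simp [Instr.block, Instr.Straight, Instr.exec])
      refine ⟨t', ht, _, hr, rfl, hs.mem, fun u hsR => ?_⟩
      by_cases h : u = r
      · subst h; simp [execAll, Instr.block, Instr.exec, hs.reg s h2, hs.reg t h3]
      · simp [execAll, Instr.block, Instr.exec, h, hs.reg u hsR]
    | load r s =>
      obtain ⟨h1, h2⟩ := hiR
      obtain ⟨t', ht, hr⟩ := reaches_next (x := x) (B' := B') (R := R) hi hs.pc
        ⟨hc', hc'.update _ _ (hc' _).2⟩ (by simp [Instr.block, Instr.Straight, Instr.exec])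
      refine ⟨t', ht, _, hr, rfl, hs.mem, fun u hsR => ?_⟩
      by_cases h : u = r
      · subst h; simp [execAll, Instr.block, Instr.exec, hs.reg s h2, hs.mem]
      · simp [execAll, Instr.block, Instr.exec, h, hs.reg u hsR]
    | store r s =>
      obtain ⟨h1, h2⟩ := hiR
      have hb : Config.Bounded B' ((Instr.store r s).exec x c') := by
        intro a
        refine ⟨(hc' a).1, ?_⟩
        by_cases ha : a = c'.reg r
        · subst ha; simpa [Instr.exec] using (hc' s).1
        · simpa [Instr.exec, ha] using (hc' a).2
      obtain ⟨t', ht, hr⟩ := reaches_next (x := x) (B' := B') (R := R) hi hs.pc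
        ⟨hc', hb⟩ (by simp [Instr.block, Instr.Straight, Instr.exec])
      refine ⟨t', ht, _, hr, rfl, ?_, fun u hsR => ?_⟩
      · simp [execAll, Instr.block, Instr.exec, hs.reg s h2, hs.reg r h1, hs.mem]
      · simp [execAll, Instr.block, Instr.exec, hs.reg u hsR]
    | input r s =>
      obtain ⟨h1, h2⟩ := hiR
      have hsB := (hc s).1
      have hreg := hs.reg s h2
      obtain ⟨g1, g2, g3, g4⟩ := e.execAll_compile (x := x) (c := c') h2 hc'
        (by rw [hreg]; exact hpeak _ hsB)
      rw [hreg, hval _ hsB] at g4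
      have hb1 := g1.bounded.update ((execAll x c' (e.compile s R)).pc + 1) (R + 1)
        (Nat.zero_le B')
      have hy : y.getD (c.reg s) 0 ≤ B := by simpa [Instr.exec] using (hc2 r).1
      obtain ⟨t', ht, hr⟩ := reaches_next (x := x) (B' := B') (R := R) hi hs.pc
        (g1.append ⟨g1.bounded, hb1, hb1.update _ _ (by
          simpa [Op.eval, Instr.exec, g4] using hy.trans hBB)⟩) (by
          intro j hj
          simp only [Instr.block, List.mem_append] at hj
          rcases hj with hj | hj
          · exact Expr.straight_of_mem_compile hj
          · simp only [List.mem_cons, List.not_mem_nil, or_false] at hj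
            rcases hj with rfl | rfl <;> (intro x c; rfl))
      refine ⟨t', ht, _, hr, rfl, ?_, fun u hsR => ?_⟩
      · simp only [Instr.block, execAll_append]
        exact g2.trans hs.mem
      · simp only [Instr.block, execAll_append]
        by_cases h : u = r
        · subst h
          simpa [execAll, Instr.exec, Op.eval] using g4
        · have h4 : u ≠ R + 1 := by omega
          have := (g3 u hsR).trans (hs.reg u hsR)
          simpa [execAll, Instr.exec, h, h4] using this
    | jump p =>
      refine ⟨1, hK, _, Reaches.single hfst hc' ?_, rfl, hs.mem, hs.reg⟩
      exact fun a => hc' a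
    | jumpZero r p =>
      have hb : Config.Bounded B' ((Instr.jumpZero r (blockLength e * p)).exec x c') :=
        fun a => hc' a
      have h1 := Reaches.single hfst hc' hb
      by_cases h0 : c.reg r = 0
      · refine ⟨1, hK, _, h1, ?_, hs.mem, hs.reg⟩
        simp [Instr.block, Instr.exec, hs.reg r hiR, h0]
      · have hK1 : 1 < blockLength e := by simp [blockLength]
        have h2 := Program.getElem?_virtualize (P := P) e R hi hK1
        have h3 : ((Instr.jumpZero r (blockLength e * p)).exec x c').pc =
            blockLength e * c.pc + 1 := by
          simp [Instr.exec, hs.reg r hiR, h0, hs.pc]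
        rw [← h3] at h2
        refine ⟨2, hK1, _, h1.trans (Reaches.single h2 hb fun a => hc' a), ?_, hs.mem, hs.reg⟩
        simp [Instr.block, Instr.exec, h0]
    | halt b =>
      exact ⟨0, Nat.zero_le _, c', Reaches.refl hc', hs⟩

/-- A program can be run on any virtual input whose entries are values of an expression on the
actual input; this costs only a constant factor in time. -/
theorem HaltsWithin.virtualize (hR : ∀ i ∈ P, i.UsesBelow R) (hBB : B ≤ B')
    (hval : ∀ p ≤ B, e.eval x p = y.getD p 0) (hpeak : ∀ p ≤ B, e.peak x p ≤ B')
    {b : Bool} {t : ℕ} (h : HaltsWithin P y b t B) :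
    ∃ t' ≤ blockLength e * t, HaltsWithin (P.virtualize e R) x b t' B' := by
  have main : ∀ j ≤ t, ∃ k ≤ blockLength e * j, ∃ c',
      Reaches (P.virtualize e R) x B' Config.init c' k ∧
        Simulates (blockLength e) R (run P y j) c' := by
    intro j
    induction j with
    | zero =>
      intro _
      exact ⟨0, Nat.zero_le _, Config.init, Reaches.refl fun a => ⟨Nat.zero_le _, Nat.zero_le _⟩,
        (Nat.mul_zero _).symm, rfl, fun _ _ => rfl⟩
    | succ j ih =>
      intro hj
      obtain ⟨k, hk, c', hreach, hsim⟩ := ih (by omega)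
      have hstep : run P y (j + 1) = RAM.step P y (run P y j) :=
        Function.iterate_succ_apply' _ _ _
      have hb : c'.Bounded B' := by
        have := hreach.2 k le_rfl
        rwa [hreach.1] at this
      obtain ⟨k', hk', c'', hr, hsim'⟩ := hsim.step hR hBB hval hpeak (h.2 j (by omega))
        (by rw [← hstep]; exact h.2 (j + 1) hj) hb
      exact ⟨k + k', by rw [mul_add, mul_one]; omega, c'', hreach.trans hr, hstep ▸ hsim'⟩
  obtain ⟨k, hk, c', hreach, hsim⟩ := main t le_rfl
  refine ⟨k, hk, ?_, hreach.2⟩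
  have hK : 0 < blockLength e := Nat.succ_pos _
  have := Program.getElem?_virtualize (P := P) e R h.1 hK
  rw [add_zero, ← hsim.pc] at this
  show (P.virtualize e R)[((RAM.step (P.virtualize e R) x)^[k] Config.init).pc]? = _
  rw [hreach.1, this]
  rfl

end

end RAM

/-! ### Functions given by arithmetic expressions -/

namespace RAM

/-- Every expression has polynomially bounded values. -/
theorem Expr.exists_peak_le (e : Expr) (c : ℕ) :
    ∃ c', ∀ (x : List ℕ) (p : ℕ), (∀ a ∈ x, a ≤ x.length + 2) → p ≤ wordBound c x →
      e.peak x p ≤ wordBound c' x := by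
  have mono : ∀ {x : List ℕ} {a b : ℕ}, a ≤ b → wordBound a x ≤ wordBound b x :=
    fun h => Nat.pow_le_pow_right (by omega) h
  induction e with
  | const k =>
    refine ⟨k, fun x p _ _ => ?_⟩
    calc k ≤ 2 ^ k := Nat.lt_two_pow_self.le
      _ ≤ _ := Nat.pow_le_pow_left (by omega) k
  | var => exact ⟨c, fun x p _ hp => hp⟩
  | op o ho a b iha ihb =>
    obtain ⟨ca, ha⟩ := iha
    obtain ⟨cb, hb⟩ := ihb
    refine ⟨(ca + 1) + (cb + 1), fun x p hx hp => ?_⟩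
    have h1 := ha x p hx hp
    have h2 := hb x p hx hp
    have succ : ∀ {v c : ℕ}, v ≤ wordBound c x → v + 1 ≤ wordBound (c + 1) x := by
      intro v c hv
      have : 1 ≤ wordBound c x := Nat.one_le_pow _ _ (by omega)
      have h3 : wordBound (c + 1) x = wordBound c x * (x.length + 2) := pow_succ _ _
      nlinarith
    refine max_le (max_le (h1.trans (mono (by omega))) (h2.trans (mono (by omega)))) ?_
    refine (ho _ _).trans ?_
    rw [show wordBound (ca + 1 + (cb + 1)) x = wordBound (ca + 1) x * wordBound (cb + 1) x from
      pow_add _ _ _]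
    exact Nat.mul_le_mul (succ ((a.eval_le_peak x p).trans h1))
      (succ ((b.eval_le_peak x p).trans h2))
  | input a iha =>
    obtain ⟨ca, ha⟩ := iha
    refine ⟨ca + 1, fun x p hx hp => max_le ((ha x p hx hp).trans (mono (by omega))) ?_⟩
    have h1 : x.getD (a.eval x p) 0 ≤ x.length + 2 := by
      rcases lt_or_ge (a.eval x p) x.length with h | h
      · rw [List.getD_eq_getElem _ _ h]
        exact hx _ (List.getElem_mem h)
      · rw [List.getD_eq_default _ _ h]
        exact Nat.zero_le _
    refine h1.trans ?_
    calc x.length + 2 = wordBound 1 x := (pow_one _).symm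
      _ ≤ _ := mono (by omega)

/-- The function `f` of the input and a number is given by an arithmetic expression. -/
def Arith (f : List ℕ → ℕ → ℕ) : Prop :=
  ∃ e : Expr, ∀ x p, e.eval x p = f x p

namespace Arith

variable {f g h k : List ℕ → ℕ → ℕ}

theorem const (a : ℕ) : Arith fun _ _ => a := ⟨.const a, fun _ _ => rfl⟩

theorem var : Arith fun _ p => p := ⟨.var, fun _ _ => rfl⟩

theorem op (o : Op) (ho : ∀ a b, o.eval a b ≤ (a + 1) * (b + 1)) (hf : Arith f) (hg : Arith g) :
    Arith fun x p => o.eval (f x p) (g x p) := by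
  obtain ⟨a, ha⟩ := hf
  obtain ⟨b, hb⟩ := hg
  exact ⟨.op o ho a b, fun x p => by simp [Expr.eval, ha, hb]⟩

theorem add (hf : Arith f) (hg : Arith g) : Arith fun x p => f x p + g x p :=
  op .add (fun a b => by simp only [Op.eval]; nlinarith) hf hg

theorem sub (hf : Arith f) (hg : Arith g) : Arith fun x p => f x p - g x p :=
  op .sub (fun a b => by
    have : a - b ≤ a := Nat.sub_le a b
    simp only [Op.eval]; nlinarith) hf hg

theorem mul (hf : Arith f) (hg : Arith g) : Arith fun x p => f x p * g x p :=
  op .mul (fun a b => by simp only [Op.eval]; nlinarith) hf hg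

theorem div (hf : Arith f) (hg : Arith g) : Arith fun x p => f x p / g x p :=
  op .div (fun a b => by
    have : a / b ≤ a := Nat.div_le_self a b
    simp only [Op.eval]; nlinarith) hf hg

theorem mod (hf : Arith f) (hg : Arith g) : Arith fun x p => f x p % g x p :=
  op .mod (fun a b => by
    have : a % b ≤ a := Nat.mod_le a b
    simp only [Op.eval]; nlinarith) hf hg

theorem input (hf : Arith f) : Arith fun x p => x.getD (f x p) 0 := by
  obtain ⟨a, ha⟩ := hf
  exact ⟨.input a, fun x p => by simp [Expr.eval, ha]⟩

/-- Case distinctions need no jumps, since truncated subtraction computes indicator functions. -/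
theorem ite_eq_zero (hf : Arith f) (hg : Arith g) (hh : Arith h) :
    Arith fun x p => if f x p = 0 then g x p else h x p := by
  have key := (((const 1).sub hf).mul hg).add (((const 1).sub ((const 1).sub hf)).mul hh)
  convert key using 3 with x p
  split_ifs with h0
  · simp [h0]
  · have : 1 - f x p = 0 := by omega
    simp [this]

theorem ite_eq (hf : Arith f) (hg : Arith g) (hh : Arith h) (hk : Arith k) :
    Arith fun x p => if f x p = g x p then h x p else k x p := by
  have key := ((hf.sub hg).add (hg.sub hf)).ite_eq_zero hh hk
  convert key using 4 with x p
  omega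

theorem ite_lt (hf : Arith f) (hg : Arith g) (hh : Arith h) (hk : Arith k) :
    Arith fun x p => if f x p < g x p then h x p else k x p := by
  have key := (hg.sub hf).ite_eq_zero hk hh
  convert key using 3 with x p
  split_ifs <;> first | rfl | omega

end Arith

end RAM

/-! ### Distance bounds in graphs -/

namespace SimpleGraph

variable {V W : Type*} {G : SimpleGraph V}

/-- The vertices `u` and `v` have distance at most `k`. -/
def Near (G : SimpleGraph V) (u v : V) (k : ℕ) : Prop :=
  G.edist u v ≤ k

theorem Near.refl (u : V) : G.Near u u 0 := by simp [Near]

theorem Near.symm {u v : V} {k : ℕ} (h : G.Near u v k) : G.Near v u k := by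
  rwa [Near, edist_comm]

theorem Near.trans {u v w : V} {k l : ℕ} (h : G.Near u v k) (h' : G.Near v w l) :
    G.Near u w (k + l) := by
  rw [Near, Nat.cast_add]
  exact G.edist_triangle.trans (add_le_add h h')

theorem Near.mono {u v : V} {k l : ℕ} (h : G.Near u v k) (hkl : k ≤ l) : G.Near u v l :=
  le_trans h (Nat.cast_le.2 hkl)

theorem Adj.near {u v : V} (h : G.Adj u v) : G.Near u v 1 := by
  rw [Near, edist_eq_one_iff_adj.2 h, Nat.cast_one]

theorem near_of_path {m : ℕ} (f : Fin (m + 1) → V)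
    (hf : ∀ s : Fin m, G.Adj (f s.castSucc) (f s.succ)) (s t : Fin (m + 1)) :
    G.Near (f s) (f t) ((t - s : ℕ) + (s - t : ℕ)) := by
  have key : ∀ k (hk : k < m + 1) (s : Fin (m + 1)), (s : ℕ) ≤ k →
      G.Near (f s) (f ⟨k, hk⟩) (k - s) := by
    intro k
    induction k with
    | zero =>
      intro hk s hs
      obtain rfl : s = ⟨0, hk⟩ := Fin.ext (by simpa using hs)
      exact (Near.refl _).mono (Nat.zero_le _)
    | succ k ih =>
      intro hk s hs
      rcases Nat.lt_or_ge k s with h | h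
      · obtain rfl : s = ⟨k + 1, hk⟩ := Fin.ext (show (s : ℕ) = k + 1 by omega)
        exact (Near.refl _).mono (Nat.zero_le _)
      · exact ((ih (by omega) s h).trans (hf ⟨k, by omega⟩).near).mono (by omega)
  rcases le_total (s : ℕ) t with h | h
  · exact (key t t.2 s h).mono (by omega)
  · exact (key s s.2 t h).symm.mono (by omega)

/-- A function that changes by at most one along each edge bounds distances from below. -/
theorem le_edist_of_lipschitz (φ : V → ℤ) (hφ : ∀ u v, G.Adj u v → φ v ≤ φ u + 1) {u v : V} {k : ℕ}
    (hk : φ u + k ≤ φ v) : (k : ℕ∞) ≤ G.edist u v := by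
  refine le_iInf fun p => Nat.cast_le.2 ?_
  have : φ v ≤ φ u + p.length := by
    clear hk
    induction p with
    | nil => simp
    | cons h p ih =>
      have := hφ _ _ h
      simp only [Walk.length_cons, Nat.cast_add, Nat.cast_one]
      omega
  omega

theorem edist_map_le {H : SimpleGraph W} (f : G →g H) (u v : V) :
    H.edist (f u) (f v) ≤ G.edist u v := by
  refine le_iInf fun p => ?_
  have := H.edist_le (p.map f)
  rwa [Walk.length_map] at this

theorem Iso.ediam_eq {H : SimpleGraph W} (f : G ≃g H) : G.ediam = H.ediam := by
  refine le_antisymm (ediam_le_of_edist_le fun u v => ?_) (ediam_le_of_edist_le fun u v => ?_)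
  · have := edist_map_le f.symm.toHom (f u) (f v)
    refine le_trans ?_ (this.trans H.edist_le_ediam)
    simp
  · have := edist_map_le f.toHom (f.symm u) (f.symm v)
    refine le_trans ?_ (this.trans G.edist_le_ediam)
    simp

end SimpleGraph

/-! ### Subdividing the connections of a graph -/

/-- A multigraph on `K` with two kinds of edges: plain ones, indexed by `D`, and connections,
indexed by `C`, which are to be replaced by paths. -/
structure Skeleton (K C D : Type*) where
  src : D → K
  dst : D → K
  start : C → K
  target : C → K

namespace Skeleton

variable {K C D : Type*} (S : Skeleton K C D) {a : ℕ}

/-- The `s`-th vertex of the path of length `a` that replaces the connection `c`, for `s ≤ a`. Only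
the `a - 1` interior vertices of the path are new; `a` is meant to be positive. -/
def point (a : ℕ) (c : C) (s : ℕ) : K ⊕ C × Fin (a - 1) :=
  if _h0 : s = 0 then .inl (S.start c) else
    if h : s < a then .inr (c, ⟨s - 1, by omega⟩) else .inl (S.target c)

/-- The first end of an edge of the subdivision. -/
def subSrc (a : ℕ) : D ⊕ C × Fin a → K ⊕ C × Fin (a - 1)
  | .inl e => .inl (S.src e)
  | .inr (c, s) => S.point a c s

/-- The second end of an edge of the subdivision. -/
def subDst (a : ℕ) : D ⊕ C × Fin a → K ⊕ C × Fin (a - 1)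
  | .inl e => .inl (S.dst e)
  | .inr (c, s) => S.point a c (s + 1)

/-- The graph in which each connection is replaced by a path of length `a`. -/
def graph (a : ℕ) : SimpleGraph (K ⊕ C × Fin (a - 1)) :=
  SimpleGraph.fromEdgeSet (Set.range fun e => s(S.subSrc a e, S.subDst a e))

/-- Any two edges or connections, and the two ends of each of them, are different. -/
structure Simple : Prop where
  ne : ∀ e, S.src e ≠ S.dst e
  start_ne : ∀ c, S.start c ≠ S.target c
  inj : Function.Injective fun e => s(S.src e, S.dst e)
  start_inj : Function.Injective fun c => s(S.start c, S.target c)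
  disj : ∀ e c, s(S.src e, S.dst e) ≠ s(S.start c, S.target c)

variable {S}

@[simp] theorem point_zero (c : C) : S.point a c 0 = .inl (S.start c) := by simp [point]

theorem point_self (ha : 0 < a) (c : C) : S.point a c a = .inl (S.target c) := by
  simp [point, ha.ne']

theorem Simple.sub_ne (h : S.Simple) (e : D ⊕ C × Fin a) : S.subSrc a e ≠ S.subDst a e := by
  rcases e with e | ⟨c, s, hs⟩
  · simpa [subSrc, subDst] using h.ne e
  · have := h.start_ne c
    simp only [subSrc, subDst, point]
    split_ifs <;> grind

theorem Simple.sub_injective (h : S.Simple) :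
    Function.Injective fun e => s(S.subSrc a e, S.subDst a e) := by
  rintro (e | ⟨c, s, hs⟩) (e' | ⟨c', s', hs'⟩) hee
  · have := @h.inj e e'
    simp only [subSrc, subDst, Sym2.eq_iff, Sum.inl.injEq] at hee this
    rw [this hee]
  · exfalso
    have := h.disj e c'
    simp only [subSrc, subDst, point, Sym2.eq_iff] at hee this
    split_ifs at hee <;> grind
  · exfalso
    have := h.disj e' c
    simp only [subSrc, subDst, point, Sym2.eq_iff] at hee this
    split_ifs at hee <;> grind
  · have := @h.start_inj c c'
    have h1 := h.start_ne c
    have h2 := h.start_ne c'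
    have key : c = c' ∧ s = s' := by
      simp only [subSrc, subDst, point, Sym2.eq_iff] at hee this
      split_ifs at hee <;> grind
    obtain ⟨rfl, rfl⟩ := key
    rfl

theorem Simple.adj (h : S.Simple) (e : D ⊕ C × Fin a) :
    (S.graph a).Adj (S.subSrc a e) (S.subDst a e) :=
  (SimpleGraph.fromEdgeSet_adj _).2 ⟨⟨e, rfl⟩, h.sub_ne e⟩

theorem Simple.edgeSet_graph (h : S.Simple) :
    (S.graph a).edgeSet = Set.range fun e => s(S.subSrc a e, S.subDst a e) := by
  rw [graph, SimpleGraph.edgeSet_fromEdgeSet, sdiff_eq_left, Set.disjoint_left]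
  rintro _ ⟨e, rfl⟩ hd
  exact h.sub_ne e (by simpa using hd)

theorem Simple.near_point (h : S.Simple) (c : C) {s t : ℕ} (hs : s ≤ a) (ht : t ≤ a) :
    (S.graph a).Near (S.point a c s) (S.point a c t) ((t - s) + (s - t)) :=
  SimpleGraph.near_of_path (fun s : Fin (a + 1) => S.point a c s)
    (fun s => h.adj (.inr (c, s))) ⟨s, by omega⟩ ⟨t, by omega⟩

/-- The extension of a function on the vertices of the skeleton to the subdivision that grows by at
most one per edge. -/
def extend (S : Skeleton K C D) (a : ℕ) (φ : K → ℤ) : K ⊕ C × Fin (a - 1) → ℤ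
  | .inl v => φ v
  | .inr (c, s) => min (φ (S.start c) + (s + 1 : ℕ)) (φ (S.target c) + (a - (s + 1 : ℕ)))

theorem extend_point {φ : K → ℤ} {c : C} {s : ℕ} (hs : s ≤ a)
    (h1 : φ (S.start c) ≤ φ (S.target c) + a) (h2 : φ (S.target c) ≤ φ (S.start c) + a) :
    S.extend a φ (S.point a c s) = min (φ (S.start c) + s) (φ (S.target c) + (a - s)) := by
  rw [point]
  split_ifs with h h'
  · subst h
    simp only [extend]
    omega
  · simp only [extend]
    omega
  · obtain rfl : s = a := by omega
    simp only [extend]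
    omega

/-- Lower bounds on distances in the subdivision can be checked on the skeleton. -/
theorem le_edist (φ : K → ℤ)
    (hD : ∀ e, φ (S.src e) ≤ φ (S.dst e) + 1 ∧ φ (S.dst e) ≤ φ (S.src e) + 1)
    (hC : ∀ c, φ (S.start c) ≤ φ (S.target c) + a ∧ φ (S.target c) ≤ φ (S.start c) + a)
    {u v : K} {k : ℕ} (hk : φ u + k ≤ φ v) :
    (k : ℕ∞) ≤ (S.graph a).edist (.inl u) (.inl v) := by
  refine SimpleGraph.le_edist_of_lipschitz (S.extend a φ) (fun u v huv => ?_) hk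
  obtain ⟨⟨e, he⟩, -⟩ := (SimpleGraph.fromEdgeSet_adj _).1 huv
  have key : S.extend a φ (S.subSrc a e) ≤ S.extend a φ (S.subDst a e) + 1 ∧
      S.extend a φ (S.subDst a e) ≤ S.extend a φ (S.subSrc a e) + 1 := by
    rcases e with e | ⟨c, s, hs⟩
    · exact hD e
    · obtain ⟨h1, h2⟩ := hC c
      simp only [subSrc, subDst]
      rw [extend_point (by omega) h1 h2, extend_point (by omega) h1 h2]
      push_cast
      omega
  rcases Sym2.eq_iff.1 he with ⟨rfl, rfl⟩ | ⟨rfl, rfl⟩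
  · exact key.2
  · exact key.1

end Skeleton

/-! ### The graph of an orthogonal vectors instance -/

namespace OVGraph

open SimpleGraph

/-- The vectors of both families: the side (`0` for the left, `1` for the right family) and the
index of the vector. -/
abbrev Row (n : ℕ) := Fin 2 × Fin n

/-- The coordinates. Each coordinate `k` has three copies: `(0, k)` stands for a one in either
family, `(1, k)` for a zero in the left family, and `(2, k)` for a zero in the right family. -/
abbrev Coord (d : ℕ) := Fin 3 × Fin d

/-- The vertices of the skeleton: for each vector a path of length `h`, for each coordinate a path
of length `q`, and one path of length `2 * h + (h + a) + q`, the spine. -/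
abbrev Core (n d h a q : ℕ) :=
  (Row n × Fin (h + 1)) ⊕ (Coord d × Fin (q + 1)) ⊕ Fin (2 * h + (h + a) + q + 1)

/-- The plain edges, those of the paths that make up the skeleton. -/
abbrev CoreEdge (n d h a q : ℕ) :=
  (Row n × Fin h) ⊕ (Coord d × Fin q) ⊕ Fin (2 * h + (h + a) + q)

/-- The connections: from each vector to one copy of each coordinate, from each vector to the center
of its side, and from the hub of each side to each copy of each coordinate. -/
abbrev Conn (n d : ℕ) := (Row n × Fin d) ⊕ Row n ⊕ (Fin 2 × Coord d)

variable {n d h a q : ℕ}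

/-- The end of the coordinate paths on the side `σ`. -/
def coordEnd (q : ℕ) (σ : Fin 2) : Fin (q + 1) :=
  ⟨σ * q, by have := Nat.mul_le_mul_right q (show (σ : ℕ) ≤ 1 by omega); omega⟩

/-- The position of the center of the side `σ` on the spine. -/
def centerPos (h a q : ℕ) (σ : Fin 2) : Fin (2 * h + (h + a) + q + 1) :=
  ⟨h + σ * (h + a + q), by
    have := Nat.mul_le_mul_right (h + a + q) (show (σ : ℕ) ≤ 1 by omega); omega⟩

/-- The position of the hub of the side `σ` on the spine. -/
def hubPos (h a q : ℕ) (σ : Fin 2) : Fin (2 * h + (h + a) + q + 1) :=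
  ⟨σ * (2 * h + (h + a) + q), by
    have := Nat.mul_le_mul_right (2 * h + (h + a) + q) (show (σ : ℕ) ≤ 1 by omega); omega⟩

/-- The copy of the coordinate `k` that the vector `r` is connected to. The two sides share a copy
only where both vectors have a one. -/
def coord (M : Fin 2 → Fin n → Fin d → Bool) (r : Row n) (k : Fin d) : Coord d :=
  (if M r.1 r.2 k then 0 else r.1.succ, k)

/-- The skeleton of the graph for the families `M 0` and `M 1`. -/
def skeleton (h a q : ℕ) (M : Fin 2 → Fin n → Fin d → Bool) :
    Skeleton (Core n d h a q) (Conn n d) (CoreEdge n d h a q) where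
  src
    | .inl (r, s) => .inl (r, s.castSucc)
    | .inr (.inl (κ, s)) => .inr (.inl (κ, s.castSucc))
    | .inr (.inr s) => .inr (.inr s.castSucc)
  dst
    | .inl (r, s) => .inl (r, s.succ)
    | .inr (.inl (κ, s)) => .inr (.inl (κ, s.succ))
    | .inr (.inr s) => .inr (.inr s.succ)
  start
    | .inl (r, _) => .inl (r, 0)
    | .inr (.inl r) => .inl (r, 0)
    | .inr (.inr (σ, _)) => .inr (.inr (hubPos h a q σ))
  target
    | .inl (r, k) => .inr (.inl (coord M r k, coordEnd q r.1))
    | .inr (.inl r) => .inr (.inr (centerPos h a q r.1))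
    | .inr (.inr (σ, κ)) => .inr (.inl (κ, coordEnd q σ))

variable {M : Fin 2 → Fin n → Fin d → Bool}

theorem hubPos_injective (ha : 0 < a) : Function.Injective (hubPos h a q) := by
  intro σ τ hστ
  have := congrArg Fin.val hστ
  simp only [hubPos] at this
  exact Fin.ext (Nat.eq_of_mul_eq_mul_right (by omega) this)

theorem simple_skeleton (ha : 0 < a) : (skeleton h a q M).Simple where
  ne := by
    rintro (⟨r, s⟩ | ⟨κ, s⟩ | s) <;> simp [skeleton, Fin.ext_iff]
  start_ne := by
    rintro (⟨r, k⟩ | r | ⟨σ, κ⟩) <;> simp [skeleton]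
  inj := by
    rintro (⟨r, s⟩ | ⟨κ, s⟩ | s) (⟨r', s'⟩ | ⟨κ', s'⟩ | s') hee <;>
      simp only [skeleton, Sym2.eq_iff, Sum.inl.injEq, Sum.inr.injEq, Prod.mk.injEq, Fin.ext_iff,
        Fin.val_castSucc, Fin.val_succ, reduceCtorEq, and_false, or_false] at hee ⊢ <;>
      grind
  start_inj := by
    have := hubPos_injective (h := h) (q := q) ha
    rintro (⟨r, k⟩ | r | ⟨σ, κ⟩) (⟨r', k'⟩ | r' | ⟨σ', κ'⟩) hee <;>
      simp only [skeleton, Sym2.eq_iff, Sum.inl.injEq, Sum.inr.injEq, Prod.mk.injEq,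
        reduceCtorEq, and_false, false_and, or_false, and_true, coord, this.eq_iff]
        at hee ⊢ <;>
      grind
  disj := by
    rintro (⟨r, s⟩ | ⟨κ, s⟩ | s) (⟨r', k'⟩ | r' | ⟨σ', κ'⟩) <;>
      simp [skeleton]

/-- The center of the side `σ`. -/
def center (n d h a q : ℕ) (σ : Fin 2) : Core n d h a q ⊕ Conn n d × Fin (a - 1) :=
  .inl (.inr (.inr (centerPos h a q σ)))

/-- The vertices in which the paths towards the coordinates start on the side `σ`: the hub, and the
first vertices of the paths of the vectors. -/
def anchor (n d h a q : ℕ) (σ : Fin 2) : Option (Fin n) → Core n d h a q ⊕ Conn n d × Fin (a - 1)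
  | none => .inl (.inr (.inr (hubPos h a q σ)))
  | some i => .inl (.inl ((σ, i), 0))

/-- A vertex on the path of a coordinate. -/
def coordVertex (n : ℕ) {d : ℕ} (h a : ℕ) {q : ℕ} (κ : Coord d) (s : Fin (q + 1)) :
    Core n d h a q ⊕ Conn n d × Fin (a - 1) :=
  .inl (.inr (.inl (κ, s)))

theorem near_tip (ha : 0 < a) (r : Row n) (s t : Fin (h + 1)) :
    ((skeleton h a q M).graph a).Near (.inl (.inl (r, s))) (.inl (.inl (r, t)))
      ((t - s : ℕ) + (s - t : ℕ)) :=
  near_of_path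
    (fun s => (.inl (.inl (r, s)) : Core n d h a q ⊕ Conn n d × Fin (a - 1)))
    (fun s => (simple_skeleton ha).adj (.inl (.inl (r, s)))) s t

theorem near_coordVertex (ha : 0 < a) (κ : Coord d) (s t : Fin (q + 1)) :
    ((skeleton h a q M).graph a).Near (coordVertex n h a κ s) (coordVertex n h a κ t)
      ((t - s : ℕ) + (s - t : ℕ)) :=
  near_of_path (fun s => coordVertex n h a κ s)
    (fun s => (simple_skeleton ha).adj (.inl (.inr (.inl (κ, s))))) s t

theorem near_spine (ha : 0 < a) (s t : Fin (2 * h + (h + a) + q + 1)) :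
    ((skeleton h a q M).graph a).Near (.inl (.inr (.inr s))) (.inl (.inr (.inr t)))
      ((t - s : ℕ) + (s - t : ℕ)) :=
  near_of_path
    (fun s => (.inl (.inr (.inr s)) : Core n d h a q ⊕ Conn n d × Fin (a - 1)))
    (fun s => (simple_skeleton ha).adj (.inl (.inr (.inr s)))) s t

theorem near_start_target (ha : 0 < a) (c : Conn n d) :
    ((skeleton h a q M).graph a).Near (.inl ((skeleton h a q M).start c))
      (.inl ((skeleton h a q M).target c)) a := by
  have := (simple_skeleton (h := h) (q := q) (M := M) ha).near_point c (Nat.zero_le a) le_rfl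
  rw [Skeleton.point_zero, Skeleton.point_self ha] at this
  exact this.mono (by omega)

theorem near_hub_coord (ha : 0 < a) (σ : Fin 2) (κ : Coord d) :
    ((skeleton h a q M).graph a).Near (anchor n d h a q σ none)
      (coordVertex n h a κ (coordEnd q σ)) a :=
  near_start_target ha (.inr (.inr (σ, κ)))

theorem near_root_coord (ha : 0 < a) (σ : Fin 2) (i : Fin n) (k : Fin d) :
    ((skeleton h a q M).graph a).Near (anchor n d h a q σ (some i))
      (coordVertex n h a (coord M (σ, i) k) (coordEnd q σ)) a :=
  near_start_target ha (.inl ((σ, i), k))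

theorem near_root_center (ha : 0 < a) (σ : Fin 2) (i : Fin n) :
    ((skeleton h a q M).graph a).Near (anchor n d h a q σ (some i)) (center n d h a q σ) a :=
  near_start_target ha (.inr (.inl (σ, i)))

theorem near_hub_center (ha : 0 < a) (σ : Fin 2) :
    ((skeleton h a q M).graph a).Near (anchor n d h a q σ none) (center n d h a q σ) h := by
  refine (near_spine ha _ _).mono ?_
  fin_cases σ <;> simp [hubPos, centerPos]; omega

theorem near_center_coord (ha : 0 < a) (σ : Fin 2) (κ : Coord d) :
    ((skeleton h a q M).graph a).Near (center n d h a q σ)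
      (coordVertex n h a κ (coordEnd q σ)) (h + a) :=
  (near_hub_center ha σ).symm.trans (near_hub_coord ha σ κ)

theorem near_center_center (ha : 0 < a) :
    ((skeleton h a q M).graph a).Near (center n d h a q 0) (center n d h a q 1) (h + a + q) := by
  refine (near_spine ha _ _).mono ?_
  simp [centerPos]

/-- The vertices of the side `σ` are close to its center, and even closer to one of its anchors. -/
def Side (M : Fin 2 → Fin n → Fin d → Bool) (σ : Fin 2)
    (v : Core n d h a q ⊕ Conn n d × Fin (a - 1)) : Prop :=
  ((skeleton h a q M).graph a).Near v (center n d h a q σ) (h + a) ∧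
    ∃ w, ((skeleton h a q M).graph a).Near v (anchor n d h a q σ w) h

/-- The remaining vertices lie between the two centers. -/
def Middle (M : Fin 2 → Fin n → Fin d → Bool)
    (v : Core n d h a q ⊕ Conn n d × Fin (a - 1)) : Prop :=
  ∃ s ≤ q, ((skeleton h a q M).graph a).Near v (center n d h a q 0) (h + a + s) ∧
    ((skeleton h a q M).graph a).Near v (center n d h a q 1) (h + a + (q - s))

/-- The interior vertices of the connections have distance at most `a - 1 ≤ h` from the anchor they
start from. -/
theorem side_or_middle (ha : 0 < a) (hh : h ≤ a) (hah : a ≤ h + 1)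
    (v : Core n d h a q ⊕ Conn n d × Fin (a - 1)) : (∃ σ, Side M σ v) ∨ Middle M v := by
  rcases v with (⟨⟨σ, i⟩, s⟩ | ⟨κ, s⟩ | s) | ⟨c, s⟩
  · left
    have h1 : ((skeleton h a q M).graph a).Near (.inl (.inl ((σ, i), s)))
        (anchor n d h a q σ (some i)) h :=
      (near_tip ha (σ, i) s 0).mono (by have := s.2; simp; omega)
    exact ⟨σ, h1.trans (near_root_center ha σ i), some i, h1⟩
  · right
    refine ⟨s, by omega, ?_, ?_⟩
    · have := (near_coordVertex (h := h) (M := M) ha κ s (coordEnd q 0)).trans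
        (near_center_coord ha 0 κ).symm
      exact this.mono (by simp [coordEnd]; omega)
    · have := (near_coordVertex (h := h) (M := M) ha κ s (coordEnd q 1)).trans
        (near_center_coord ha 1 κ).symm
      exact this.mono (by simp [coordEnd]; omega)
  · have h0 := near_spine (M := M) ha s (centerPos h a q 0)
    have h1 := near_spine (M := M) ha s (centerPos h a q 1)
    have g0 := near_spine (M := M) ha s (hubPos h a q 0)
    have g1 := near_spine (M := M) ha s (hubPos h a q 1)
    have e0 : (centerPos h a q 0 : ℕ) = h := by simp [centerPos]
    have e1 : (centerPos h a q 1 : ℕ) = h + (h + a + q) := by simp [centerPos]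
    have e2 : (hubPos h a q 0 : ℕ) = 0 := by simp [hubPos]
    have e3 : (hubPos h a q 1 : ℕ) = 2 * h + (h + a) + q := by simp [hubPos]
    have hs := s.2
    rcases le_or_gt (s : ℕ) h with hs0 | hs0
    · exact .inl ⟨0, h0.mono (by omega), none, g0.mono (by omega)⟩
    rcases le_or_gt (h + (h + a + q)) (s : ℕ) with hs1 | hs1
    · exact .inl ⟨1, h1.mono (by omega), none, g1.mono (by omega)⟩
    · -- Up to distance `h + a` from the left center, the vertex is as good as one with offset `0`
      -- on a coordinate path.
      exact .inr ⟨s - h - (h + a), by omega, h0.mono (by omega), h1.mono (by omega)⟩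
  · left
    have hs := s.2
    have hp : (.inr (c, s) : Core n d h a q ⊕ Conn n d × Fin (a - 1)) =
        (skeleton h a q M).point a c (s + 1) := by
      simp only [Skeleton.point, Nat.add_eq_zero_iff, one_ne_zero, and_false, dite_false,
        Nat.add_sub_cancel]
      rw [dif_pos (by omega)]
    have h1 : ((skeleton h a q M).graph a).Near (.inr (c, s))
        (.inl ((skeleton h a q M).start c)) (s + 1) := by
      have := (simple_skeleton (h := h) (q := q) (M := M) ha).near_point c
        (show (s : ℕ) + 1 ≤ a by omega) (Nat.zero_le a)
      rw [Skeleton.point_zero, ← hp] at this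
      exact this.mono (by omega)
    rcases c with ⟨⟨σ, i⟩, k⟩ | ⟨σ, i⟩ | ⟨σ, κ⟩
    · exact ⟨σ, (h1.trans (near_root_center ha σ i)).mono (by omega), some i, h1.mono (by omega)⟩
    · exact ⟨σ, (h1.trans (near_root_center ha σ i)).mono (by omega), some i, h1.mono (by omega)⟩
    · exact ⟨σ, (h1.trans (near_hub_center ha σ)).mono (by omega), none, h1.mono (by omega)⟩

/-- If each two vectors from different sides share a one, then any two anchors on different sides
are joined through a coordinate. -/
theorem near_anchor_anchor (ha : 0 < a) (hd : 0 < d)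
    (hM : ∀ i j, ∃ k, M 0 i k = true ∧ M 1 j k = true) (v w : Option (Fin n)) :
    ((skeleton h a q M).graph a).Near (anchor n d h a q 0 v) (anchor n d h a q 1 w)
      (2 * a + q) := by
  suffices ∃ κ, ((skeleton h a q M).graph a).Near (anchor n d h a q 0 v)
      (coordVertex n h a κ (coordEnd q 0)) a ∧ ((skeleton h a q M).graph a).Near
      (anchor n d h a q 1 w) (coordVertex n h a κ (coordEnd q 1)) a by
    obtain ⟨κ, h1, h2⟩ := this
    refine ((h1.trans (near_coordVertex ha κ _ (coordEnd q 1))).trans h2.symm).mono ?_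
    simp [coordEnd]; omega
  cases v with
  | none =>
    cases w with
    | none => exact ⟨(0, ⟨0, hd⟩), near_hub_coord ha _ _, near_hub_coord ha _ _⟩
    | some j => exact ⟨_, near_hub_coord ha _ _, near_root_coord ha 1 j ⟨0, hd⟩⟩
  | some i =>
    cases w with
    | none => exact ⟨_, near_root_coord ha 0 i ⟨0, hd⟩, near_hub_coord ha _ _⟩
    | some j =>
      obtain ⟨k, hi, hj⟩ := hM i j
      have e : coord M (0, i) k = coord M (1, j) k := by simp [coord, hi, hj]
      exact ⟨_, near_root_coord ha 0 i k, e ▸ near_root_coord ha 1 j k⟩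

/-- Only the distances between vertices on different sides depend on the vectors: all others are at
most `2 * (h + a) + q`. -/
theorem ediam_le_of_cross {D : ℕ} (ha : 0 < a) (hh : h ≤ a) (hah : a ≤ h + 1)
    (hD : 2 * (h + a) + q ≤ D)
    (hcross : ∀ u v, Side M 0 u → Side M 1 v → ((skeleton h a q M).graph a).Near u v D) :
    ((skeleton h a q M).graph a).ediam ≤ D := by
  have mid : ∀ u v, Middle M u → (∃ σ, Side M σ v) →
      ((skeleton h a q M).graph a).Near u v D := by
    rintro u v ⟨s, hs, h0, h1⟩ ⟨σ, hv, -⟩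
    obtain rfl | rfl : σ = 0 ∨ σ = 1 := by fin_cases σ <;> simp
    · exact (h0.trans hv.symm).mono (by omega)
    · exact (h1.trans hv.symm).mono (by omega)
  refine ediam_le_of_edist_le fun u v => ?_
  change ((skeleton h a q M).graph a).Near u v D
  rcases side_or_middle (M := M) ha hh hah u with hu | hu <;>
    rcases side_or_middle (M := M) ha hh hah v with hv | hv
  · obtain ⟨σ, hu⟩ := hu
    obtain ⟨τ, hv⟩ := hv
    by_cases hστ : σ = τ
    · subst hστ
      exact (hu.1.trans hv.1.symm).mono (by omega)
    · obtain ⟨rfl, rfl⟩ | ⟨rfl, rfl⟩ : (σ = 0 ∧ τ = 1) ∨ (σ = 1 ∧ τ = 0) := by omega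
      · exact hcross u v hu hv
      · exact (hcross v u hv hu).symm
  · exact (mid v u hv hu).symm
  · exact mid u v hu hv
  · obtain ⟨s, hs, h0, h1⟩ := hu
    obtain ⟨t, ht, g0, g1⟩ := hv
    -- The ways through the two centers have total length `4 * (h + a) + 2 * q`.
    rcases le_total (s + t) q with hst | hst
    · exact (h0.trans g0.symm).mono (by omega)
    · exact (h1.trans g1.symm).mono (by omega)

theorem ediam_le_of_common (ha : 0 < a) (hh : h ≤ a) (hah : a ≤ h + 1) (hd : 0 < d)
    (hM : ∀ i j, ∃ k, M 0 i k = true ∧ M 1 j k = true) :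
    ((skeleton h a q M).graph a).ediam ≤ (2 * (h + a) + q : ℕ) := by
  refine ediam_le_of_cross ha hh hah le_rfl ?_
  rintro u v ⟨-, w, hu⟩ ⟨-, w', hv⟩
  exact ((hu.trans (near_anchor_anchor ha hd hM w w')).trans hv.symm).mono (by omega)

theorem ediam_le (ha : 0 < a) (hh : h ≤ a) (hah : a ≤ h + 1) :
    ((skeleton h a q M).graph a).ediam ≤ (3 * (h + a) + q : ℕ) := by
  refine ediam_le_of_cross ha hh hah (by omega) ?_
  rintro u v ⟨hu, -⟩ ⟨hv, -⟩
  exact ((hu.trans (near_center_center ha)).trans hv.symm).mono (by omega)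

/-- The position on the way from the left to the right vectors through the coordinates. -/
def position (n d h a q : ℕ) : Core n d h a q → ℤ
  | .inl ((σ, _), s) => if σ = 0 then h - (s : ℕ) else h + a + q + a + (s : ℕ)
  | .inr (.inl (_, s)) => h + a + (s : ℕ)
  | .inr (.inr s) => h + a + min (max ((s : ℕ) - h) 0) q

/-- The far ends of the paths of a left and a right vector are never closer. -/
theorem le_ediam (hn : 0 < n) (hh : h ≤ a) :
    ((2 * (h + a) + q : ℕ) : ℕ∞) ≤ ((skeleton h a q M).graph a).ediam := by
  refine le_trans ?_ (edist_le_ediam (u := .inl (.inl ((0, ⟨0, hn⟩), Fin.last h)))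
    (v := .inl (.inl ((1, ⟨0, hn⟩), Fin.last h))))
  refine Skeleton.le_edist (position n d h a q) ?_ ?_ ?_
  · rintro (⟨⟨σ, i⟩, s⟩ | ⟨κ, s⟩ | s) <;> simp only [skeleton, position, Fin.val_castSucc,
      Fin.val_succ] <;> push_cast
    · split_ifs <;> omega
    · omega
    · omega
  · rintro (⟨⟨σ, i⟩, k⟩ | ⟨σ, i⟩ | ⟨σ, κ⟩) <;> fin_cases σ <;>
      simp [skeleton, position, coordEnd, centerPos, hubPos] <;> omega
  · simp [position]
    omega

open Classical in
/-- A lower bound for the distances of the skeleton vertices from the far end of the path of the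
left vector `i₀`, valid if `i₀` and the right vector `j₀` have no common one. Along the spine it
falls from the left hub to the left center, rises up to the right center, and falls again. -/
def height (h a q : ℕ) (M : Fin 2 → Fin n → Fin d → Bool) (i₀ j₀ : Fin n) : Core n d h a q → ℤ
  | .inl ((σ, i), s) =>
    if σ = 0 then if i = i₀ then h - (s : ℕ) else h + a + a
    else if i = j₀ then 2 * (h + a) + q + a + (s : ℕ) else h + a + q + a
  | .inr (.inl (κ, s)) => (if ∃ k, coord M (0, i₀) k = κ then h + a else 2 * (h + a)) + (s : ℕ)
  | .inr (.inr s) =>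
    min (h + a + max ((s : ℕ) - h) (h - (s : ℕ))) (3 * (h + a) + 2 * q + h - (s : ℕ))

theorem le_ediam_of_orthogonal (hh : h ≤ a) (hah : a ≤ h + 1) (i₀ j₀ : Fin n)
    (hM : ∀ k, M 0 i₀ k = false ∨ M 1 j₀ k = false) :
    ((3 * (h + a) + q : ℕ) : ℕ∞) ≤ ((skeleton h a q M).graph a).ediam := by
  have hK : ∀ k, ¬ ∃ k', coord M (0, i₀) k' = coord M (1, j₀) k := by
    rintro k ⟨k', hk⟩
    simp only [coord, Prod.mk.injEq] at hk
    obtain ⟨h1, rfl⟩ := hk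
    -- A shared copy of the coordinate has index `0`, since `Fin.succ 0 ≠ Fin.succ 1`.
    have h0 := hM k'
    revert h0 h1
    cases M 0 i₀ k' <;> cases M 1 j₀ k' <;> simp
  refine le_trans ?_ (edist_le_ediam (u := .inl (.inl ((0, i₀), Fin.last h)))
    (v := .inl (.inl ((1, j₀), Fin.last h))))
  refine Skeleton.le_edist (height h a q M i₀ j₀) ?_ ?_ ?_
  · rintro (⟨⟨σ, i⟩, s⟩ | ⟨κ, s⟩ | s) <;> simp only [skeleton, height, Fin.val_castSucc,
      Fin.val_succ] <;> push_cast
    · split_ifs <;> omega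
    · omega
    · omega
  · rintro (⟨⟨σ, i⟩, k⟩ | ⟨σ, i⟩ | ⟨σ, κ⟩)
    · obtain rfl | rfl : σ = 0 ∨ σ = 1 := by omega
      · by_cases hi : i = i₀
        · subst hi
          simp [skeleton, height, coordEnd]
          omega
        · simp only [skeleton, height, coordEnd, hi, if_false]
          split_ifs <;> simp <;> omega
      · by_cases hi : i = j₀
        · subst hi
          simp only [skeleton, height, coordEnd, hK]
          simp
          omega
        · simp only [skeleton, height, coordEnd, hi, if_false]
          split_ifs <;> simp <;> omega
    · obtain rfl | rfl : σ = 0 ∨ σ = 1 := by omega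
      · simp only [skeleton, height, centerPos]
        split_ifs <;> simp <;> omega
      · simp only [skeleton, height, centerPos]
        split_ifs <;> simp <;> omega
    · obtain rfl | rfl : σ = 0 ∨ σ = 1 := by omega
      · simp only [skeleton, height, coordEnd, hubPos]
        split_ifs <;> simp <;> omega
      · simp only [skeleton, height, coordEnd, hubPos]
        split_ifs <;> simp <;> omega
  · simp [height]
    omega

end OVGraph

/-! ### Numbering the vertices and edges -/

namespace OVGraph

/-- The numbering of a product, row by row. -/
def prodNum {A : Type*} {m : ℕ} (e : A ≃ Fin m) (k : ℕ) : A × Fin k ≃ Fin (m * k) :=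
  (e.prodCongr (Equiv.refl _)).trans finProdFinEquiv

/-- The numbering of a disjoint union. -/
def sumNum {A B : Type*} {m k : ℕ} (e : A ≃ Fin m) (f : B ≃ Fin k) : A ⊕ B ≃ Fin (m + k) :=
  (e.sumCongr f).trans finSumFinEquiv

@[simp] theorem prodNum_apply {A : Type*} {m : ℕ} (e : A ≃ Fin m) (k : ℕ) (x : A) (s : Fin k) :
    (prodNum e k (x, s) : ℕ) = s + k * e x := rfl

@[simp] theorem sumNum_inl {A B : Type*} {m k : ℕ} (e : A ≃ Fin m) (f : B ≃ Fin k) (x : A) :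
    (sumNum e f (.inl x) : ℕ) = e x := rfl

@[simp] theorem sumNum_inr {A B : Type*} {m k : ℕ} (e : A ≃ Fin m) (f : B ≃ Fin k) (x : B) :
    (sumNum e f (.inr x) : ℕ) = m + f x := rfl

/-- The numbering of the vectors. -/
abbrev rowNum (n : ℕ) : Row n ≃ Fin (2 * n) := prodNum (Equiv.refl _) n

/-- The numbering of the copies of the coordinates. -/
abbrev coordNum (d : ℕ) : Coord d ≃ Fin (3 * d) := prodNum (Equiv.refl _) d

/-- The numbering of the connections. -/
abbrev connNum (n d : ℕ) : Conn n d ≃ Fin (2 * n * d + (2 * n + 2 * (3 * d))) :=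
  sumNum (prodNum (rowNum n) d) (sumNum (rowNum n)
    (((Equiv.refl _).prodCongr (coordNum d)).trans (prodNum (Equiv.refl _) (3 * d))))

/-- The number of vertices of the skeleton. -/
def numCore (n d h a q : ℕ) : ℕ :=
  2 * n * (h + 1) + (3 * d * (q + 1) + (2 * h + (h + a) + q + 1))

/-- The number of connections. -/
def numConn (n d : ℕ) : ℕ := 2 * n * d + (2 * n + 2 * (3 * d))

/-- The number of vertices. -/
def numVert (n d h a q : ℕ) : ℕ := numCore n d h a q + numConn n d * (a - 1)

/-- The number of edges. -/
def numEdge (n d h a q : ℕ) : ℕ :=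
  2 * n * h + (3 * d * q + (2 * h + (h + a) + q)) + numConn n d * a

/-- The numbering of the vertices. -/
def vertNum (n d h a q : ℕ) :
    Core n d h a q ⊕ Conn n d × Fin (a - 1) ≃ Fin (numVert n d h a q) :=
  sumNum (sumNum (prodNum (rowNum n) (h + 1))
    (sumNum (prodNum (coordNum d) (q + 1)) (Equiv.refl _))) (prodNum (connNum n d) (a - 1))

/-- The numbering of the edges. -/
def edgeNum (n d h a q : ℕ) :
    CoreEdge n d h a q ⊕ Conn n d × Fin a ≃ Fin (numEdge n d h a q) :=
  sumNum (sumNum (prodNum (rowNum n) h)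
    (sumNum (prodNum (coordNum d) q) (Equiv.refl _))) (prodNum (connNum n d) a)

/-- The number of a vertex on the path of a coordinate. -/
def coordVertexNum (n h q κ s : ℕ) : ℕ := 2 * n * (h + 1) + (s + (q + 1) * κ)

/-- The number of a vertex on the spine. -/
def spineNum (n d h q s : ℕ) : ℕ := 2 * n * (h + 1) + (3 * d * (q + 1) + s)

/-- The number of the first end of the connection with number `c`. -/
def startNum (n d h a q c : ℕ) : ℕ :=
  if c < 2 * n * d then (h + 1) * (c / d)
  else if c - 2 * n * d < 2 * n then (h + 1) * (c - 2 * n * d)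
  else spineNum n d h q ((c - 2 * n * d - 2 * n) / (3 * d) * (2 * h + (h + a) + q))

/-- The number of the second end of the connection with number `c`, where `b` lists the entries of
all vectors. -/
def targetNum (n d h a q : ℕ) (b : ℕ → ℕ) (c : ℕ) : ℕ :=
  if c < 2 * n * d then
    coordVertexNum n h q (c % d + d * ((1 - b c) * (c / d / n + 1))) (c / d / n * q)
  else if c - 2 * n * d < 2 * n then
    spineNum n d h q (h + (c - 2 * n * d) / n * (h + a + q))
  else
    coordVertexNum n h q ((c - 2 * n * d - 2 * n) % (3 * d))
      ((c - 2 * n * d - 2 * n) / (3 * d) * q)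

/-- The number of the `s`-th vertex on the path that replaces the connection with number `c`. -/
def pointNum (n d h a q : ℕ) (b : ℕ → ℕ) (c s : ℕ) : ℕ :=
  if s = 0 then startNum n d h a q c
  else if s < a then numCore n d h a q + ((s - 1) + (a - 1) * c)
  else targetNum n d h a q b c

/-- The number of the first (`o = 0`) or second (`o = 1`) end of the edge with number `e`. -/
def endNum (n d h a q : ℕ) (b : ℕ → ℕ) (e o : ℕ) : ℕ :=
  if e < 2 * n * h then (e % h + o) + (h + 1) * (e / h)
  else if e - 2 * n * h < 3 * d * q then
    coordVertexNum n h q ((e - 2 * n * h) / q) ((e - 2 * n * h) % q + o)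
  else if e - 2 * n * h - 3 * d * q < 2 * h + (h + a) + q then
    spineNum n d h q (e - 2 * n * h - 3 * d * q + o)
  else
    pointNum n d h a q b ((e - 2 * n * h - 3 * d * q - (2 * h + (h + a) + q)) / a)
      ((e - 2 * n * h - 3 * d * q - (2 * h + (h + a) + q)) % a + o)

theorem add_mul_div_of_lt {s k : ℕ} (r : ℕ) (hs : s < k) : (s + k * r) / k = r := by
  rw [Nat.add_mul_div_left _ _ (by omega), Nat.div_eq_of_lt hs, zero_add]

theorem add_mul_mod_of_lt {s k : ℕ} (r : ℕ) (hs : s < k) : (s + k * r) % k = s := by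
  rw [Nat.add_mul_mod_self_left, Nat.mod_eq_of_lt hs]

variable {n d h a q : ℕ} {M : Fin 2 → Fin n → Fin d → Bool} {b : ℕ → ℕ}

theorem vertNum_row (r : Row n) (s : Fin (h + 1)) :
    (vertNum n d h a q (.inl (.inl (r, s))) : ℕ) = s + (h + 1) * rowNum n r := rfl

theorem vertNum_coord (κ : Coord d) (s : Fin (q + 1)) :
    (vertNum n d h a q (.inl (.inr (.inl (κ, s)))) : ℕ) =
      coordVertexNum n h q (coordNum d κ) s := rfl

theorem vertNum_spine (s : Fin (2 * h + (h + a) + q + 1)) :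
    (vertNum n d h a q (.inl (.inr (.inr s))) : ℕ) = spineNum n d h q s := rfl

theorem startNum_connNum (c : Conn n d) :
    startNum n d h a q (connNum n d c) =
      vertNum n d h a q (.inl ((skeleton h a q M).start c)) := by
  rcases c with ⟨r, k⟩ | r | ⟨σ, κ⟩
  · have h1 : ((connNum n d (.inl (r, k)) : ℕ)) = k + d * rowNum n r := rfl
    have h2 := (prodNum (rowNum n) d (r, k)).2
    rw [prodNum_apply] at h2
    rw [h1, startNum, if_pos h2, add_mul_div_of_lt _ k.2]
    simp [vertNum_row, skeleton]
  · have h1 : ((connNum n d (.inr (.inl r)) : ℕ)) = 2 * n * d + rowNum n r := rfl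
    have h2 := (rowNum n r).2
    rw [h1, startNum, if_neg (by omega), Nat.add_sub_cancel_left, if_pos h2]
    simp [vertNum_row, skeleton]
  · have h1 : ((connNum n d (.inr (.inr (σ, κ))) : ℕ)) =
      2 * n * d + (2 * n + (coordNum d κ + 3 * d * σ)) := rfl
    rw [h1, startNum, if_neg (by omega), Nat.add_sub_cancel_left, if_neg (by omega),
      Nat.add_sub_cancel_left, add_mul_div_of_lt _ (coordNum d κ).2]
    simp [vertNum_spine, skeleton, hubPos]

theorem targetNum_connNum (hb : ∀ σ i (k : Fin d), b (k + d * rowNum n (σ, i)) = (M σ i k).toNat)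
    (c : Conn n d) :
    targetNum n d h a q b (connNum n d c) =
      vertNum n d h a q (.inl ((skeleton h a q M).target c)) := by
  rcases c with ⟨⟨σ, i⟩, k⟩ | ⟨σ, i⟩ | ⟨σ, κ⟩
  · have h1 : ((connNum n d (.inl ((σ, i), k)) : ℕ)) = k + d * rowNum n (σ, i) := rfl
    have h2 := (prodNum (rowNum n) d ((σ, i), k)).2
    rw [prodNum_apply] at h2
    have h3 : (rowNum n (σ, i) : ℕ) / n = σ := add_mul_div_of_lt _ i.2
    rw [h1, targetNum, if_pos h2, add_mul_div_of_lt _ k.2, add_mul_mod_of_lt _ k.2, h3, hb]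
    cases hM : M σ i k <;> simp [vertNum_coord, skeleton, coord, coordEnd, hM]
  · have h1 : ((connNum n d (.inr (.inl (σ, i))) : ℕ)) = 2 * n * d + rowNum n (σ, i) := rfl
    have h2 := (rowNum n (σ, i)).2
    have h3 : (rowNum n (σ, i) : ℕ) / n = σ := add_mul_div_of_lt _ i.2
    rw [h1, targetNum, if_neg (by omega), Nat.add_sub_cancel_left, if_pos h2, h3]
    simp [vertNum_spine, skeleton, centerPos]
  · have h1 : ((connNum n d (.inr (.inr (σ, κ))) : ℕ)) =
      2 * n * d + (2 * n + (coordNum d κ + 3 * d * σ)) := rfl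
    rw [h1, targetNum, if_neg (by omega), Nat.add_sub_cancel_left, if_neg (by omega),
      Nat.add_sub_cancel_left, add_mul_div_of_lt _ (coordNum d κ).2,
      add_mul_mod_of_lt _ (coordNum d κ).2]
    simp [vertNum_coord, skeleton, coordEnd]

theorem pointNum_connNum (hb : ∀ σ i (k : Fin d), b (k + d * rowNum n (σ, i)) = (M σ i k).toNat)
    (c : Conn n d) (s : ℕ) :
    pointNum n d h a q b (connNum n d c) s =
      vertNum n d h a q ((skeleton h a q M).point a c s) := by
  simp only [pointNum, Skeleton.point]
  split_ifs
  · exact startNum_connNum c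
  · rfl
  · exact targetNum_connNum hb c

theorem endNum_edgeNum (hb : ∀ σ i (k : Fin d), b (k + d * rowNum n (σ, i)) = (M σ i k).toNat)
    (e : CoreEdge n d h a q ⊕ Conn n d × Fin a) :
    endNum n d h a q b (edgeNum n d h a q e) 0 =
        vertNum n d h a q ((skeleton h a q M).subSrc a e) ∧
      endNum n d h a q b (edgeNum n d h a q e) 1 =
        vertNum n d h a q ((skeleton h a q M).subDst a e) := by
  rcases e with (⟨r, s⟩ | ⟨κ, s⟩ | s) | ⟨c, s⟩
  · have h1 : ((edgeNum n d h a q (.inl (.inl (r, s))) : ℕ)) = s + h * rowNum n r := rfl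
    have h2 := (prodNum (rowNum n) h (r, s)).2
    rw [prodNum_apply] at h2
    simp only [h1, endNum, if_pos h2, add_mul_div_of_lt _ s.2, add_mul_mod_of_lt _ s.2]
    exact ⟨rfl, rfl⟩
  · have h1 : ((edgeNum n d h a q (.inl (.inr (.inl (κ, s)))) : ℕ)) =
      2 * n * h + (s + q * coordNum d κ) := rfl
    have h2 := (prodNum (coordNum d) q (κ, s)).2
    have h3 : ¬ (2 * n * h + (s + q * coordNum d κ) < 2 * n * h) := by omega
    rw [prodNum_apply] at h2
    simp only [h1, endNum, if_neg h3, Nat.add_sub_cancel_left, if_pos h2,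
      add_mul_div_of_lt _ s.2, add_mul_mod_of_lt _ s.2]
    exact ⟨rfl, rfl⟩
  · have h1 : ((edgeNum n d h a q (.inl (.inr (.inr s))) : ℕ)) =
      2 * n * h + (3 * d * q + s) := rfl
    have h3 : ¬ (2 * n * h + (3 * d * q + s) < 2 * n * h) := by omega
    have h4 : ¬ (3 * d * q + s < 3 * d * q) := by omega
    simp only [h1, endNum, if_neg h3, Nat.add_sub_cancel_left, if_neg h4, if_pos s.2]
    exact ⟨rfl, rfl⟩
  · have h1 : ((edgeNum n d h a q (.inr (c, s)) : ℕ)) =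
      2 * n * h + (3 * d * q + (2 * h + (h + a) + q)) + (s + a * connNum n d c) := rfl
    have h2 : 2 * n * h + (3 * d * q + (2 * h + (h + a) + q)) + (s + a * connNum n d c) =
        2 * n * h + (3 * d * q + ((2 * h + (h + a) + q) + (s + a * connNum n d c))) := by ring
    have h3 : ∀ x y : ℕ, ¬ (x + y < x) := by omega
    simp only [h1, h2, endNum, if_neg (h3 _ _), Nat.add_sub_cancel_left,
      add_mul_div_of_lt _ s.2, add_mul_mod_of_lt _ s.2, pointNum_connNum hb]
    exact ⟨rfl, rfl⟩

/-- The graph of the families `M 0` and `M 1`, with its vertices replaced by their numbers. -/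
def numberedGraph (h a q : ℕ) (M : Fin 2 → Fin n → Fin d → Bool) :
    SimpleGraph (Fin (numVert n d h a q)) :=
  ((skeleton h a q M).graph a).map (vertNum n d h a q)

/-- The edges of the graph, in the order of their numbers. -/
def edgeList (h a q : ℕ) (M : Fin 2 → Fin n → Fin d → Bool) :
    List (Fin (numVert n d h a q) × Fin (numVert n d h a q)) :=
  List.ofFn fun e : Fin (numEdge n d h a q) =>
    (vertNum n d h a q ((skeleton h a q M).subSrc a ((edgeNum n d h a q).symm e)),
      vertNum n d h a q ((skeleton h a q M).subDst a ((edgeNum n d h a q).symm e)))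

theorem ediam_numberedGraph :
    (numberedGraph h a q M).ediam = ((skeleton h a q M).graph a).ediam :=
  (SimpleGraph.Iso.map (vertNum n d h a q) _).ediam_eq.symm

theorem isEdgeList_edgeList (ha : 0 < a) :
    GraphInput.IsEdgeList (numberedGraph h a q M) (edgeList h a q M) := by
  have hS := simple_skeleton (h := h) (q := q) (M := M) ha
  have hmap : (edgeList h a q M).map (fun e => s(e.1, e.2)) =
      List.ofFn fun e : Fin (numEdge n d h a q) => Sym2.map (vertNum n d h a q)
        (s((skeleton h a q M).subSrc a ((edgeNum n d h a q).symm e),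
          (skeleton h a q M).subDst a ((edgeNum n d h a q).symm e))) := by
    simp [edgeList, List.map_ofFn, Function.comp_def]
  rw [GraphInput.IsEdgeList, hmap]
  refine ⟨?_, fun e => ?_⟩
  · rw [List.nodup_ofFn]
    exact (Sym2.map.injective (vertNum n d h a q).injective).comp
      (hS.sub_injective.comp (edgeNum n d h a q).symm.injective)
  · have : (numberedGraph h a q M).edgeSet =
        Sym2.map (vertNum n d h a q) '' ((skeleton h a q M).graph a).edgeSet :=
      SimpleGraph.edgeSet_map (vertNum n d h a q).toEmbedding _
    rw [this, hS.edgeSet_graph, ← Set.range_comp, List.mem_ofFn]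
    constructor
    · rintro ⟨i, rfl⟩
      exact ⟨(edgeNum n d h a q).symm i, rfl⟩
    · rintro ⟨i, rfl⟩
      exact ⟨edgeNum n d h a q i, by simp⟩

end OVGraph

theorem GraphInput.IsEdgeList.ncard_edgeSet {N : ℕ} {G : SimpleGraph (Fin N)}
    {es : List (Fin N × Fin N)} (h : IsEdgeList G es) : G.edgeSet.ncard = es.length := by
  classical
  have : G.edgeSet = ((es.map fun e => s(e.1, e.2)).toFinset : Set (Sym2 (Fin N))) := by
    ext e
    rw [← h.2 e]
    simp only [List.coe_toFinset, Set.mem_ofPred_eq]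
  rw [this, Set.ncard_coe_finset, List.toFinset_card_of_nodup h.1, List.length_map]

/-! ### The encoding of the graph is computed by an arithmetic expression -/

namespace OVGraph

variable {n d h a q : ℕ} {M : Fin 2 → Fin n → Fin d → Bool} {b : ℕ → ℕ}

/-- The entry at position `p` of the encoding of the graph, where `b` lists the entries of all
vectors. -/
def entry (n d h a q : ℕ) (b : ℕ → ℕ) (p : ℕ) : ℕ :=
  if p < 4 then
    if p = 0 then numVert n d h a q else if p = 1 then numEdge n d h a q
    else if p = 2 then h + a else q
  else if (p - 4) / 2 < numEdge n d h a q then endNum n d h a q b ((p - 4) / 2) ((p - 4) % 2)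
  else 0

theorem getElem?_flatMap_pair {α β : Type*} (u v : α → β) (l : List α) (j : ℕ) :
    (l.flatMap fun e => [u e, v e])[j]? =
      l[j / 2]?.map fun e => if j % 2 = 0 then u e else v e := by
  induction l generalizing j with
  | nil => simp
  | cons x l ih =>
    match j with
    | 0 => simp
    | 1 => simp
    | j + 2 =>
      have h1 : (j + 2) / 2 = j / 2 + 1 := by omega
      have h2 : (j + 2) % 2 = j % 2 := by omega
      rw [h1, h2]
      simpa using ih j

theorem entry_eq (hb : ∀ σ i (k : Fin d), b (k + d * rowNum n (σ, i)) = (M σ i k).toNat) (p : ℕ) :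
    entry n d h a q b p = (GraphInput.encode (edgeList h a q M) (h + a) q).getD p 0 := by
  match p with
  | 0 => simp [entry, GraphInput.encode]
  | 1 => simp [entry, GraphInput.encode, edgeList]
  | 2 => simp [entry, GraphInput.encode]
  | 3 => simp [entry, GraphInput.encode]
  | p + 4 =>
    have h0 : ¬ (p + 4 < 4) := by omega
    rw [entry, if_neg h0, Nat.add_sub_cancel]
    simp only [GraphInput.encode, List.getD_cons_succ]
    rw [List.getD_eq_getElem?_getD, getElem?_flatMap_pair]
    by_cases h1 : p / 2 < numEdge n d h a q
    · obtain ⟨e, he⟩ := (edgeNum n d h a q).surjective ⟨p / 2, h1⟩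
      have hv : p / 2 = edgeNum n d h a q e := by rw [he]
      have hE := endNum_edgeNum (h := h) (a := a) (q := q) hb e
      have hl : (edgeList h a q M)[p / 2]? =
          some (vertNum n d h a q ((skeleton h a q M).subSrc a e),
            vertNum n d h a q ((skeleton h a q M).subDst a e)) := by
        rw [edgeList, List.getElem?_ofFn, dif_pos h1, ← he, Equiv.symm_apply_apply]
      rw [if_pos h1, hl, hv]
      rcases Nat.mod_two_eq_zero_or_one p with h2 | h2
      · simp [h2, hE.1]
      · simp [h2, hE.2]
    · have hl : (edgeList h a q M)[p / 2]? = none := by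
        rw [List.getElem?_eq_none_iff]
        simp only [edgeList, List.length_ofFn]
        omega
      rw [if_neg h1, hl]
      rfl

section arith

open RAM

variable {N D : List ℕ → ℕ → ℕ} {B : List ℕ → ℕ → ℕ → ℕ} {f g : List ℕ → ℕ → ℕ}

theorem arith_numCore (hN : Arith N) (hD : Arith D) (h a q : ℕ) :
    Arith fun x p => numCore (N x p) (D x p) h a q :=
  (((Arith.const 2).mul hN).mul (.const (h + 1))).add
    ((((Arith.const 3).mul hD).mul (.const (q + 1))).add (.const (2 * h + (h + a) + q + 1)))

theorem arith_numConn (hN : Arith N) (hD : Arith D) :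
    Arith fun x p => numConn (N x p) (D x p) :=
  ((((Arith.const 2).mul hN).mul hD)).add
    (((Arith.const 2).mul hN).add ((Arith.const 2).mul ((Arith.const 3).mul hD)))

theorem arith_numVert (hN : Arith N) (hD : Arith D) (h a q : ℕ) :
    Arith fun x p => numVert (N x p) (D x p) h a q :=
  (arith_numCore hN hD h a q).add ((arith_numConn hN hD).mul (.const (a - 1)))

theorem arith_numEdge (hN : Arith N) (hD : Arith D) (h a q : ℕ) :
    Arith fun x p => numEdge (N x p) (D x p) h a q :=
  ((((Arith.const 2).mul hN).mul (.const h)).add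
    ((((Arith.const 3).mul hD).mul (.const q)).add (.const (2 * h + (h + a) + q)))).add
    ((arith_numConn hN hD).mul (.const a))

theorem arith_coordVertexNum (hN : Arith N) (h q : ℕ) (hf : Arith f) (hg : Arith g) :
    Arith fun x p => coordVertexNum (N x p) h q (f x p) (g x p) :=
  (((Arith.const 2).mul hN).mul (.const (h + 1))).add
    (hg.add ((Arith.const (q + 1)).mul hf))

theorem arith_spineNum (hN : Arith N) (hD : Arith D) (h q : ℕ) (hf : Arith f) :
    Arith fun x p => spineNum (N x p) (D x p) h q (f x p) :=
  (((Arith.const 2).mul hN).mul (.const (h + 1))).add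
    ((((Arith.const 3).mul hD).mul (.const (q + 1))).add hf)

theorem arith_startNum (hN : Arith N) (hD : Arith D) (h a q : ℕ) (hf : Arith f) :
    Arith fun x p => startNum (N x p) (D x p) h a q (f x p) := by
  have h1 := ((Arith.const 2).mul hN).mul hD
  have h2 := hf.sub h1
  exact hf.ite_lt h1 ((Arith.const (h + 1)).mul (hf.div hD))
    (h2.ite_lt ((Arith.const 2).mul hN) ((Arith.const (h + 1)).mul h2)
      (arith_spineNum hN hD h q (((h2.sub ((Arith.const 2).mul hN)).div
        ((Arith.const 3).mul hD)).mul (.const (2 * h + (h + a) + q)))))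

theorem arith_targetNum (hN : Arith N) (hD : Arith D)
    (hB : ∀ {f : List ℕ → ℕ → ℕ}, Arith f → Arith fun x p => B x p (f x p))
    (h a q : ℕ) (hf : Arith f) :
    Arith fun x p => targetNum (N x p) (D x p) h a q (B x p) (f x p) := by
  have h1 := ((Arith.const 2).mul hN).mul hD
  have h2 := hf.sub h1
  have h3 := (hf.div hD).div hN
  have h4 := h2.sub ((Arith.const 2).mul hN)
  have h5 := (Arith.const 3).mul hD
  exact hf.ite_lt h1
    (arith_coordVertexNum hN h q
      ((hf.mod hD).add (hD.mul (((Arith.const 1).sub (hB hf)).mul (h3.add (.const 1)))))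
      (h3.mul (.const q)))
    (h2.ite_lt ((Arith.const 2).mul hN)
      (arith_spineNum hN hD h q ((Arith.const h).add ((h2.div hN).mul (.const (h + a + q)))))
      (arith_coordVertexNum hN h q (h4.mod h5) ((h4.div h5).mul (.const q))))

theorem arith_pointNum (hN : Arith N) (hD : Arith D)
    (hB : ∀ {f : List ℕ → ℕ → ℕ}, Arith f → Arith fun x p => B x p (f x p))
    (h a q : ℕ) (hf : Arith f) (hg : Arith g) :
    Arith fun x p => pointNum (N x p) (D x p) h a q (B x p) (f x p) (g x p) :=
  hg.ite_eq_zero (arith_startNum hN hD h a q hf)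
    (hg.ite_lt (.const a)
      ((arith_numCore hN hD h a q).add ((hg.sub (.const 1)).add ((Arith.const (a - 1)).mul hf)))
      (arith_targetNum hN hD hB h a q hf))

theorem arith_endNum (hN : Arith N) (hD : Arith D)
    (hB : ∀ {f : List ℕ → ℕ → ℕ}, Arith f → Arith fun x p => B x p (f x p))
    (h a q : ℕ) (hf : Arith f) (hg : Arith g) :
    Arith fun x p => endNum (N x p) (D x p) h a q (B x p) (f x p) (g x p) := by
  have h1 := ((Arith.const 2).mul hN).mul (.const h)
  have h2 := hf.sub h1
  have h3 := ((Arith.const 3).mul hD).mul (.const q)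
  have h4 := h2.sub h3
  have h5 := h4.sub (.const (2 * h + (h + a) + q))
  exact hf.ite_lt h1
    (((hf.mod (.const h)).add hg).add ((Arith.const (h + 1)).mul (hf.div (.const h))))
    (h2.ite_lt h3
      (arith_coordVertexNum hN h q (h2.div (.const q)) ((h2.mod (.const q)).add hg))
      (h4.ite_lt (.const (2 * h + (h + a) + q))
        (arith_spineNum hN hD h q (h4.add hg))
        (arith_pointNum hN hD hB h a q (h5.div (.const a)) ((h5.mod (.const a)).add hg))))

theorem arith_entry (hN : Arith N) (hD : Arith D)
    (hB : ∀ {f : List ℕ → ℕ → ℕ}, Arith f → Arith fun x p => B x p (f x p)) (h a q : ℕ) :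
    Arith fun x p => entry (N x p) (D x p) h a q (B x p) p := by
  have hp := Arith.var
  have h4 := hp.sub (.const 4)
  exact hp.ite_lt (.const 4)
    (hp.ite_eq_zero (arith_numVert hN hD h a q)
      (hp.ite_eq (.const 1) (arith_numEdge hN hD h a q)
        (hp.ite_eq (.const 2) (.const (h + a)) (.const q))))
    ((h4.div (.const 2)).ite_lt (arith_numEdge hN hD h a q)
      (arith_endNum hN hD hB h a q (h4.div (.const 2)) (h4.mod (.const 2))) (.const 0))

end arith

end OVGraph

/-! ### The encoding of an orthogonal vectors instance -/

namespace OrthogonalVectors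

variable {n d : ℕ}

/-- The entry of row `i` and column `k` is in position `k + d * i`. -/
theorem encodeRows_eq_ofFn (M : Fin n → Fin d → Bool) :
    encodeRows M = List.ofFn fun p : Fin (n * d) => (M p.divNat p.modNat).toNat := by
  rw [List.ofFn_mul, encodeRows]
  congr 1
  refine List.ofFn_inj.2 (funext fun i => List.ofFn_inj.2 (funext fun k => ?_))
  have hk : (finProdFinEquiv (i, k)) = (⟨i * d + k, by
    have := (finProdFinEquiv (i, k)).2
    simp only [finProdFinEquiv_apply_val] at this
    rw [mul_comm d] at this
    omega⟩ : Fin (n * d)) := Fin.ext (by simp [finProdFinEquiv_apply_val]; ring)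
  have h1 := congrArg Prod.fst ((finProdFinEquiv (m := n) (n := d)).symm_apply_apply (i, k))
  have h2 := congrArg Prod.snd ((finProdFinEquiv (m := n) (n := d)).symm_apply_apply (i, k))
  rw [hk] at h1 h2
  simp only [finProdFinEquiv_symm_apply] at h1 h2
  rw [h1, h2]

theorem length_encodeRows (M : Fin n → Fin d → Bool) : (encodeRows M).length = n * d := by
  rw [encodeRows_eq_ofFn, List.length_ofFn]

theorem getElem?_encodeRows (M : Fin n → Fin d → Bool) (i : Fin n) (k : Fin d) :
    (encodeRows M)[k + d * i]? = some (M i k).toNat := by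
  have h := (finProdFinEquiv (i, k)).2
  have h1 := congrArg Prod.fst ((finProdFinEquiv (m := n) (n := d)).symm_apply_apply (i, k))
  have h2 := congrArg Prod.snd ((finProdFinEquiv (m := n) (n := d)).symm_apply_apply (i, k))
  simp only [finProdFinEquiv_symm_apply] at h1 h2
  rw [encodeRows_eq_ofFn, List.getElem?_ofFn]
  exact (dif_pos h).trans <| congrArg some (congrArg Bool.toNat (congrArg₂ M h1 h2))

theorem length_encode (L R : Fin n → Fin d → Bool) : (encode L R).length = 2 * (n * d) + 2 := by
  simp only [encode, List.length_cons, List.length_append, length_encodeRows]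
  ring

theorem getD_encode (L R : Fin n → Fin d → Bool) (σ : Fin 2) (i : Fin n) (k : Fin d) :
    (encode L R).getD (2 + (k + d * OVGraph.rowNum n (σ, i))) 0 =
      ((![L, R] : Fin 2 → Fin n → Fin d → Bool) σ i k).toNat := by
  have h := (finProdFinEquiv (i, k)).2
  simp only [finProdFinEquiv_apply_val] at h
  rw [List.getD_eq_getElem?_getD, encode, add_comm 2, List.getElem?_cons_succ,
    List.getElem?_cons_succ, OVGraph.prodNum_apply]
  obtain rfl | rfl : σ = 0 ∨ σ = 1 := by omega
  · rw [List.getElem?_append_left (by simpa [length_encodeRows] using h)]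
    simp [getElem?_encodeRows]
  · have e : (k + d * (i + n * ((Equiv.refl (Fin 2)) 1 : Fin 2)) : ℕ) =
        (encodeRows L).length + (k + d * i) := by
      rw [length_encodeRows]; simp; ring
    rw [e, List.getElem?_append_right (Nat.le_add_right _ _), Nat.add_sub_cancel_left,
      getElem?_encodeRows]
    simp

theorem le_of_mem_encode (hn : 1 ≤ n) (hd : 1 ≤ d) (L R : Fin n → Fin d → Bool) :
    ∀ v ∈ encode L R, v ≤ (encode L R).length + 2 := by
  intro v hv
  rw [length_encode]
  have hrows : ∀ M : Fin n → Fin d → Bool, v ∈ encodeRows M → v ≤ 1 := by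
    intro M hM
    rw [encodeRows_eq_ofFn, List.mem_ofFn] at hM
    obtain ⟨p, rfl⟩ := hM
    exact Bool.toNat_le _
  have h1 : n ≤ n * d := Nat.le_mul_of_pos_right n hd
  have h2 : d ≤ n * d := Nat.le_mul_of_pos_left d hn
  simp only [encode, List.mem_cons, List.mem_append] at hv
  rcases hv with rfl | rfl | hv | hv
  · omega
  · omega
  · have := hrows L hv; omega
  · have := hrows R hv; omega

end OrthogonalVectors

/-! ### The reduction -/

namespace OVGraph

variable {n d h a q : ℕ}

theorem ediam_numberedGraph_eq (ha : 0 < a) (hh : h ≤ a) (hah : a ≤ h + 1) (hn : 1 ≤ n)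
    (hd : 1 ≤ d) (L R : Fin n → Fin d → Bool) {b : Bool}
    (hb : b = true ↔ OrthogonalVectors.HasOrthogonalPair L R) :
    (numberedGraph h a q ![L, R]).ediam =
      ((if b then 3 * (h + a) + q else 2 * (h + a) + q : ℕ) : ℕ∞) := by
  rw [ediam_numberedGraph]
  cases b with
  | true =>
    obtain ⟨i, j, hij⟩ := hb.1 rfl
    exact le_antisymm (ediam_le ha hh hah) (le_ediam_of_orthogonal hh hah i j hij)
  | false =>
    refine le_antisymm (ediam_le_of_common ha hh hah hd fun i j => ?_) (le_ediam hn hh)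
    by_contra! hij
    refine absurd (hb.2 ⟨i, j, fun k => ?_⟩) (by simp)
    have := hij k
    change L i k = true → R j k ≠ true at this
    revert this
    cases L i k <;> cases R j k <;> simp

theorem numEdge_le (hn : 1 ≤ n) (hd : 1 ≤ d) :
    numEdge n d h a q ≤ (5 * h + 4 * q + 11 * a) * (n * d) := by
  have h1 : n ≤ n * d := Nat.le_mul_of_pos_right n hd
  have h2 : d ≤ n * d := Nat.le_mul_of_pos_left d hn
  have h3 : 1 ≤ n * d := hn.trans h1
  have e1 := Nat.mul_le_mul_right (2 * h + 2 * a) h1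
  have e2 := Nat.mul_le_mul_right (3 * q + 6 * a) h2
  have e3 := Nat.mul_le_mul_right (3 * h + a + q) h3
  rw [numEdge, numConn]
  nlinarith

theorem numEdge_pos (ha : 0 < a) : 0 < numEdge n d h a q := by
  rw [numEdge]; omega

theorem length_edgeList (M : Fin 2 → Fin n → Fin d → Bool) :
    (edgeList h a q M).length = numEdge n d h a q := by
  simp [edgeList]

theorem length_encode_edgeList (M : Fin 2 → Fin n → Fin d → Bool) (ℓ : ℕ) :
    (GraphInput.encode (edgeList h a q M) ℓ q).length = 2 * numEdge n d h a q + 4 := by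
  simp [GraphInput.encode, List.length_flatMap, length_edgeList, mul_comm]

/-- Words for the graph are words for the vectors, up to a constant factor in the number of bits. -/
theorem wordBound_encode_le (hn : 1 ≤ n) (hd : 1 ≤ d) (L R : Fin n → Fin d → Bool) (c ℓ : ℕ) :
    RAM.wordBound c (GraphInput.encode (edgeList h a q ![L, R]) ℓ q) ≤
      RAM.wordBound ((5 * h + 4 * q + 11 * a + 4) * c) (OrthogonalVectors.encode L R) := by
  rw [RAM.wordBound, RAM.wordBound, length_encode_edgeList, OrthogonalVectors.length_encode,
    pow_mul]
  refine Nat.pow_le_pow_left ?_ c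
  have h1 := numEdge_le (h := h) (a := a) (q := q) hn hd
  set A := 5 * h + 4 * q + 11 * a
  have h2 : A + 3 < 2 ^ (A + 3) := Nat.lt_two_pow_self
  have h3 : 2 ^ (A + 3) ≤ (2 * (n * d) + 2 + 2) ^ (A + 3) := Nat.pow_le_pow_left (by omega) _
  calc 2 * numEdge n d h a q + 4 + 2 ≤ (A + 3) * (2 * (n * d) + 2 + 2) := by nlinarith
    _ ≤ (2 * (n * d) + 2 + 2) ^ (A + 3) * (2 * (n * d) + 2 + 2) :=
        Nat.mul_le_mul_right _ (h2.le.trans h3)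
    _ = _ := (pow_succ _ _).symm

/-- A time bound in terms of the number of edges is one in terms of the vectors. Passing to
`min δ 1` keeps the exponent nonnegative. -/
theorem numEdge_rpow_le {δ : ℝ} (ha : 0 < a) (hn : 1 ≤ n) (hd : 1 ≤ d) (hδ : 0 < δ) :
    (numEdge n d h a q : ℝ) ^ (2 - δ) ≤
      (n : ℝ) ^ (2 - min δ 1) * (((5 * h + 4 * q + 11 * a : ℕ) : ℝ) ^ 2 * (d : ℝ) ^ 2) := by
  have hm : (1 : ℝ) ≤ numEdge n d h a q := by exact_mod_cast numEdge_pos ha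
  have hle : (numEdge n d h a q : ℝ) ≤ n * (((5 * h + 4 * q + 11 * a : ℕ) : ℝ) * d) := by
    have := numEdge_le (h := h) (a := a) (q := q) hn hd
    calc (numEdge n d h a q : ℝ) ≤ ((5 * h + 4 * q + 11 * a : ℕ) * (n * d) : ℕ) := by
          exact_mod_cast this
      _ = _ := by push_cast; ring
  set A := 5 * h + 4 * q + 11 * a with hA
  have hAd : (1 : ℝ) ≤ A * d := by
    have : 1 ≤ A * d := Nat.mul_pos (by omega) hd
    exact_mod_cast this
  have hδ1 : min δ 1 ≤ 1 := min_le_right _ _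
  have hδ0 : 0 < min δ 1 := lt_min hδ one_pos
  calc (numEdge n d h a q : ℝ) ^ (2 - δ) ≤ (numEdge n d h a q : ℝ) ^ (2 - min δ 1) :=
        Real.rpow_le_rpow_of_exponent_le hm (by linarith [min_le_left δ 1])
    _ ≤ (n * (A * d : ℝ)) ^ (2 - min δ 1) :=
        Real.rpow_le_rpow (by linarith) hle (by linarith)
    _ = (n : ℝ) ^ (2 - min δ 1) * (A * d : ℝ) ^ (2 - min δ 1) :=
        Real.mul_rpow (Nat.cast_nonneg _) (by linarith)
    _ ≤ (n : ℝ) ^ (2 - min δ 1) * (A * d : ℝ) ^ (2 : ℝ) :=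
        mul_le_mul_of_nonneg_left (Real.rpow_le_rpow_of_exponent_le hAd (by linarith))
          (by positivity)
    _ = _ := by rw [Real.rpow_two, mul_pow]

/-- The entries of the encoding of the graph are the values of one expression on the encoding of
the vectors. -/
theorem exists_expr_encode (h a q : ℕ) :
    ∃ e : RAM.Expr, ∀ (n d : ℕ) (L R : Fin n → Fin d → Bool) (p : ℕ),
      e.eval (OrthogonalVectors.encode L R) p =
        (GraphInput.encode (edgeList h a q ![L, R]) (h + a) q).getD p 0 := by
  obtain ⟨e, he⟩ := arith_entry (RAM.Arith.input (.const 0)) (RAM.Arith.input (.const 1))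
    (B := fun x _ j => x.getD (2 + j) 0) (fun hf => RAM.Arith.input ((RAM.Arith.const 2).add hf))
    h a q
  refine ⟨e, fun n d L R p => ?_⟩
  rw [he, ← entry_eq (b := fun j => (OrthogonalVectors.encode L R).getD (2 + j) 0)
    (fun σ i k => OrthogonalVectors.getD_encode L R σ i k)]
  rfl

end OVGraph

theorem mainTheorem5 (hOVH : OrthogonalVectors.Hypothesis)
    (S : Set (ℕ × ℕ)) (hS : S.Nonempty) (hℓ : ∀ a ∈ S, 1 ≤ a.1) (δ : ℝ) (hδ : 0 < δ) :
    ¬ ∃ (P : RAM.Program) (c : ℕ) (C : ℝ),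
      DistinguishesDiameter S P c fun m ℓ q =>
        C * ((m : ℝ) ^ (2 - δ) / ((ℓ : ℝ) + (q : ℝ)) ^ (2 - δ)) := by
  classical
  -- A single pair of parameters suffices.
  rintro ⟨P, c, C, hP⟩
  obtain ⟨⟨ℓ, q⟩, hmem⟩ := hS
  have hpos : 1 ≤ ℓ := hℓ _ hmem
  obtain ⟨h, a, rfl, hh, hah, ha⟩ : ∃ h a, ℓ = h + a ∧ h ≤ a ∧ a ≤ h + 1 ∧ 0 < a :=
    ⟨ℓ / 2, ℓ - ℓ / 2, by omega, by omega, by omega, by omega⟩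
  obtain ⟨e, he⟩ := OVGraph.exists_expr_encode h a q
  obtain ⟨R₀, hR₀⟩ := RAM.Program.exists_usesBelow P
  set A := 5 * h + 4 * q + 11 * a with hA
  obtain ⟨c', hc'⟩ := e.exists_peak_le ((A + 4) * c)
  set D : ℝ := (((h + a : ℕ) : ℝ) + (q : ℝ)) ^ (2 - δ) with hD
  have hD0 : 0 < D := Real.rpow_pos_of_pos (by positivity) _
  set k : ℕ := ⌈RAM.blockLength e * (|C| / D)⌉₊ with hk
  refine hOVH (min δ 1) (lt_min hδ one_pos) ⟨P.virtualize e R₀, max ((A + 4) * c) c',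
    Polynomial.C (k * A ^ 2) * Polynomial.X ^ 2, fun n d hn hd L R => ?_⟩
  have hedge := OVGraph.isEdgeList_edgeList (h := h) (q := q) (M := ![L, R]) ha
  obtain ⟨t, ht, hhalt⟩ := hP _ _ hmem _ _ _ hedge _
    (OVGraph.ediam_numberedGraph_eq ha hh hah hn hd L R decide_eq_true_iff)
  have mono : ∀ {i j : ℕ}, i ≤ j → RAM.wordBound i (OrthogonalVectors.encode L R) ≤
      RAM.wordBound j (OrthogonalVectors.encode L R) := fun hij =>
    Nat.pow_le_pow_right (by omega) hij
  have hword := OVGraph.wordBound_encode_le (h := h) (a := a) (q := q) hn hd L R c (h + a)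
  obtain ⟨t', ht', hhalt'⟩ := hhalt.virtualize hR₀ (hword.trans (mono (le_max_left _ c')))
    (fun p _ => he n d L R p) (fun p hp =>
      (hc' _ p (OrthogonalVectors.le_of_mem_encode hn hd L R) (hp.trans hword)).trans
        (mono (le_max_right _ _)))
  refine ⟨t', ?_, hhalt'⟩
  rw [hedge.ncard_edgeSet, OVGraph.length_edgeList] at ht
  beta_reduce at ht
  rw [← hD] at ht
  have hX := OVGraph.numEdge_rpow_le (h := h) (q := q) ha hn hd hδ
  rw [← hA] at hX
  set X : ℝ := (OVGraph.numEdge n d h a q : ℝ) ^ (2 - δ) with hXdef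
  have hX0 : 0 ≤ X := Real.rpow_nonneg (Nat.cast_nonneg _) _
  calc (t' : ℝ) ≤ RAM.blockLength e * t := by exact_mod_cast ht'
    _ ≤ RAM.blockLength e * (|C| * (X / D)) := by
        gcongr
        refine ht.trans ?_
        gcongr
        exact le_abs_self C
    _ = RAM.blockLength e * (|C| / D) * X := by ring
    _ ≤ k * ((n : ℝ) ^ (2 - min δ 1) * ((A : ℝ) ^ 2 * (d : ℝ) ^ 2)) := by
        gcongr
        exact Nat.le_ceil _
    _ = _ := by
        simp only [Polynomial.eval_mul, Polynomial.eval_C, Polynomial.eval_pow, Polynomial.eval_X]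
        push_cast
        ring
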